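/- Let $d\ge 1$, write $[d]=\{1,\dots,d\}$, and let $\mathbf n=(n_1,\dots,n_d)$ be a tuple of positive integers. A rooted multitype Cayley tree of profile $\mathbf n$ is a tree (connected acyclic graph) with vertex set $\{(t,i): t\in[d],\ 1\le i\le n_t\}$ together with a distinguished root vertex; edges are oriented toward the root, and the vertex $(t,i)$ has type $t$. A vertex has complete degree type $(t,u,\mathbf c)$, with $\mathbf c=(c_1,\dots,c_d)$, if it has type $t$, its parent has type $u\in[d+1]$ (by convention the fictitious parent of the root has type $d+1$), and it has exactly $c_s$ children of type $s$ for every $s\in[d]$. Let $\mathcal C=\prod_{s\in[d]}\{0,1,\dots,n_s\}$ and let $(N_{t,u,\mathbf c})_{t\in[d],\,u\in[d+1],\,\mathbf c\in\mathcal C}$ be non-negative integers. Put $$m_{t,u}=\sum_{\mathbf c\in\mathcal C}N_{t,u,\mathbf c},\qquad m_{s,t,u}=\sum_{\mathbf c\in\mathcal C}c_s\,N_{t,u,\mathbf c},\qquad N(k)=\sum_{\substack{s,t\in[d],\ u\in[d+1],\ \mathbf c\in\mathcal C\\ c_s=k}}N_{t,u,\mathbf c},$$ and suppose that $n_t=\sum_{u\in[d+1]}m_{t,u}$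 for all $t\in[d]$. Let $\mu_s=m_{s,s}-m_{s,s,s}$ if $m_{s,s}>0$ and $\mu_s=1$ if $m_{s,s}=0$. Suppose moreover that every pair $(s,t)\in[d]\times[d+1]$ with $m_{s,t}>0$ satisfies $t\le s+1$. If $m_{s,d+1}=\delta_{s,d}$ for all $s\in[d]$ and $m_{s,t}=\sum_{u\in[d+1]}m_{s,t,u}$ for all $s,t\in[d]$, then the number of rooted multitype Cayley trees of profile $\mathbf n$ whose root has type $d$ and which have exactly $N_{t,u,\mathbf c}$ vertices of complete degree type $(t,u,\mathbf c)$ for all $t\in[d]$, $u\in[d+1]$, $\mathbf c\in\mathcal C$ is $$\frac{\prod_{t\in[d]}n_t!\ \prod_{s,t\in[d],\,m_{s,t}>0}(m_{s,t}-1)!}{\prod_{t,u\in[d],\,\mathbf c\in\mathcal C}N_{t,u,\mathbf c}!\ \prod_{k\ge0}k!^{N(k)}}\times\prod_{\substack{s,t\in[d]\\ t<s,\ m_{s,t}>0}}m_{s,t}\times\mu_1\prod_{s=2}^{d}\bigl(m_{s-1,s,s+1}\,\mu_s+m_{s-1,s,s}\,m_{s,s,s+1}\bigr).$$ If these conditions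 on the $m$'s do not hold, there is no such tree. -/

import Mathlib

open scoped Nat

namespace MultitypeCayley

/-- Vertices `(t, i)` of profile `n = (n 0, …, n (d-1))`: `t` is the type, `i` the label.
Types and labels are numbered from zero. -/
abbrev Vertex {d : ℕ} (n : Fin d → ℕ) : Type := (t : Fin d) × Fin (n t)

/-- Rooted multitype Cayley trees of profile `n`. -/
@[ext]
structure RootedTree {d : ℕ} (n : Fin d → ℕ) where
  graph : SimpleGraph (Vertex n)
  isTree : graph.IsTree
  root : Vertex n

instance {d : ℕ} (n : Fin d → ℕ) : Finite (RootedTree n) :=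
  Finite.of_injective (fun T : RootedTree n => (T.graph, T.root)) (by
    intro T T' h
    simp only [Prod.mk.injEq] at h
    exact RootedTree.ext h.1 h.2)

namespace RootedTree

variable {d : ℕ} {n : Fin d → ℕ}

/-- `T.IsChild w v`: the edge `w – v` belongs to `T` and is oriented from the child `w` to its
parent `v`, that is, toward the root. -/
def IsChild (T : RootedTree n) (w v : Vertex n) : Prop :=
  T.graph.Adj w v ∧ T.graph.dist w T.root = T.graph.dist v T.root + 1

/-- The number of children of type `s` of the vertex `v`. -/
noncomputable def indegree (T : RootedTree n) (s : Fin d) (v : Vertex n) : ℕ :=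
  {w : Vertex n | w.1 = s ∧ T.IsChild w v}.ncard

/-- `T.HasParentType v u`: the parent of `v` has type `u`, where `Fin.last d` (the extra type) is
the type of the fictitious parent of the root. -/
def HasParentType (T : RootedTree n) (v : Vertex n) (u : Fin (d + 1)) : Prop :=
  (v = T.root ∧ u = Fin.last d) ∨ ∃ p : Vertex n, T.IsChild v p ∧ u = p.1.castSucc

/-- The number of vertices of complete degree type `(t, u, c)`. -/
noncomputable def completeTypeCount (T : RootedTree n) (t : Fin d) (u : Fin (d + 1))
    (c : Fin d → ℕ) : ℕ :=
  {v : Vertex n | v.1 = t ∧ T.HasParentType v u ∧ ∀ s, T.indegree s v = c s}.ncard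

end RootedTree

/-- The possible indegree types `c = (c_s)_s` with `0 ≤ c_s ≤ n_s`. -/
abbrev IndegType {d : ℕ} (n : Fin d → ℕ) : Type := (s : Fin d) → Fin (n s + 1)

section Counts

variable {d : ℕ} {n : Fin d → ℕ}

/-- The set of rooted trees of profile `n` with a root of type `ρ` and, for all `t, u, c`, exactly
`N t u c` vertices of complete degree type `(t, u, c)`. -/
def treesOfCompleteType (ρ : Fin d) (N : Fin d → Fin (d + 1) → IndegType n → ℕ) :
    Set (RootedTree n) :=
  {T | T.root.1 = ρ ∧ ∀ t u (c : IndegType n), T.completeTypeCount t u (fun s => c s) = N t u c}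

/-- `m_{t,u} = ∑_c N_{t,u,c}`. -/
def m₂ (N : Fin d → Fin (d + 1) → IndegType n → ℕ) (t : Fin d) (u : Fin (d + 1)) : ℕ :=
  ∑ c : IndegType n, N t u c

/-- `m_{s,t,u} = ∑_c c_s N_{t,u,c}`. -/
def m₃ (N : Fin d → Fin (d + 1) → IndegType n → ℕ) (s t : Fin d) (u : Fin (d + 1)) : ℕ :=
  ∑ c : IndegType n, (c s : ℕ) * N t u c

/-- `N(k)`, the sum of `N_{t,u,c}` over all `s, t, u, c` with `c_s = k`. -/
def indegreeCount (N : Fin d → Fin (d + 1) → IndegType n → ℕ) (k : ℕ) : ℕ :=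
  ∑ s : Fin d, ∑ t : Fin d, ∑ u : Fin (d + 1), ∑ c : IndegType n,
    if (c s : ℕ) = k then N t u c else 0

/-- Only finitely many factors of `∏ k!^N(k)` differ from one. -/
theorem finite_mulSupport_factorial (N : Fin d → Fin (d + 1) → IndegType n → ℕ) :
    (Function.mulSupport fun k : ℕ => (k ! : ℚ) ^ indegreeCount N k).Finite := by
  refine (Set.finite_Iic (∑ s, n s)).subset fun k hk => ?_
  by_contra hlt
  refine hk ?_
  have h0 : indegreeCount N k = 0 := by
    refine Finset.sum_eq_zero fun s _ => Finset.sum_eq_zero fun t _ =>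
      Finset.sum_eq_zero fun u _ => Finset.sum_eq_zero fun c _ => if_neg ?_
    have h1 : n s ≤ ∑ s, n s := Finset.single_le_sum (fun _ _ => Nat.zero_le _) (Finset.mem_univ s)
    have h2 := (c s).isLt
    simp only [Set.mem_Iic, not_le] at hlt
    omega
  simp [h0]

/-- The consistency conditions `m_{s,d+1} = δ_{s,ρ}` and `m_{s,t} = ∑_u m_{s,t,u}`. -/
def Compatible (ρ : Fin d) (N : Fin d → Fin (d + 1) → IndegType n → ℕ) : Prop :=
  (∀ s, m₂ N s (Fin.last d) = if s = ρ then 1 else 0) ∧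
    ∀ s t : Fin d, m₂ N s t.castSucc = ∑ u : Fin (d + 1), m₃ N s t u

/-- `μ_s = m_{s,s} - m_{s,s,s}` if `m_{s,s} > 0`, and `μ_s = 1` if `m_{s,s} = 0`. -/
def mu (N : Fin d → Fin (d + 1) → IndegType n → ℕ) (s : Fin d) : ℚ :=
  if 0 < m₂ N s s.castSucc then (m₂ N s s.castSucc : ℚ) - m₃ N s s s.castSucc else 1

end Counts

end MultitypeCayley

namespace MultitypeCayley

set_option linter.unusedSectionVars false

/-- The partial map `f` has no cycles (and no infinite orbits): some rank decreases along it. -/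
def AcyclicMap {α : Type*} (f : α → Option α) : Prop :=
  ∃ h : α → ℕ, ∀ x y, f x = some y → h y < h x

theorem acyclicMap_update_iff {α : Type*} [DecidableEq α] {f : α → Option α} {a : α}
    {b : Option α} (hf : ∀ x, x ≠ a → f x ≠ some a) (hb : b ≠ some a) :
    AcyclicMap (Function.update f a b) ↔ AcyclicMap (Function.update f a none) := by
  constructor
  · rintro ⟨h, hh⟩
    refine ⟨h, fun x y hxy => ?_⟩
    rcases eq_or_ne x a with rfl | hx
    · simp at hxy
    · exact hh x y (by simpa [hx] using hxy)
  · rintro ⟨h, hh⟩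
    refine ⟨Function.update h a (b.elim 0 h + 1), fun x y hxy => ?_⟩
    rcases eq_or_ne x a with rfl | hx
    · have hb' : b = some y := by simpa using hxy
      have hy : y ≠ x := by rintro rfl; exact hb hb'
      simp [hy, hb']
    · have hxy' : f x = some y := by simpa [hx] using hxy
      have hy : y ≠ a := by rintro rfl; exact hf x hx hxy'
      simpa [hx, hy] using hh x y (by simpa [hx] using hxy')

/-- An acyclic map leaves every nonempty set. -/
theorem acyclicMap_exists_exit {A : Type*} {σ : A → Option A} (hσ : AcyclicMap σ) {Z : A → Prop}
    (hZ : ∃ a, Z a) : ∃ a, Z a ∧ ∀ b, σ a = some b → ¬ Z b := by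
  obtain ⟨h, hh⟩ := hσ
  obtain ⟨a, ha, hmin⟩ := exists_minimalFor_of_wellFoundedLT Z h hZ
  exact ⟨a, ha, fun b hb hZb => absurd (hmin hZb (hh a b hb).le) (hh a b hb).not_ge⟩

section AcyclicSum

variable {A : Type*} [Fintype A] [DecidableEq A]

open Classical in
/-- The sum of the weights `∏ a, w a (σ a)` of all acyclic partial maps `σ`. -/
noncomputable def acyclicSum (w : A → Option A → ℚ) : ℚ :=
  ∑ σ : A → Option A, if AcyclicMap σ then ∏ a, w a (σ a) else 0

theorem prod_update_apply (w : A → Option A → ℚ) (a : A) (r : Option A → ℚ) (σ : A → Option A) :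
    ∏ a', Function.update w a r a' (σ a') =
      r (σ a) * ∏ a' ∈ Finset.univ.erase a, w a' (σ a') := by
  rw [← Finset.mul_prod_erase _ _ (Finset.mem_univ a)]
  congr 1
  · simp
  · refine Finset.prod_congr rfl fun x hx => ?_
    simp [Finset.ne_of_mem_erase hx]

theorem acyclicSum_update_sum (w : A → Option A → ℚ) (a : A) {ι : Type*} (s : Finset ι)
    (x : ι → ℚ) (r : ι → Option A → ℚ) :
    acyclicSum (Function.update w a fun b => ∑ i ∈ s, x i * r i b) =
      ∑ i ∈ s, x i * acyclicSum (Function.update w a (r i)) := by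
  unfold acyclicSum
  simp_rw [prod_update_apply, Finset.mul_sum]
  rw [Finset.sum_comm]
  refine Finset.sum_congr rfl fun σ _ => ?_
  split_ifs
  · rw [Finset.sum_mul]
    exact Finset.sum_congr rfl fun i _ => by ring
  · simp

theorem acyclicSum_update_single_of_forall_eq_zero {w : A → Option A → ℚ} {a : A}
    (hw : ∀ a', w a' (some a) = 0) {b : Option A} (hb : b ≠ some a) :
    acyclicSum (Function.update w a (Pi.single b 1)) =
      acyclicSum (Function.update w a (Pi.single none 1)) := by
  unfold acyclicSum
  simp_rw [prod_update_apply]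
  refine Fintype.sum_equiv
    (Equiv.piCongrRight fun a' => if a' = a then Equiv.swap b none else Equiv.refl _) _ _ ?_
  intro σ
  set τ := (Equiv.piCongrRight fun a' : A =>
    if a' = a then Equiv.swap b none else Equiv.refl (Option A)) σ with hτ
  have hτa : τ a = Equiv.swap b none (σ a) := by simp [hτ]
  have hτne : ∀ a', a' ≠ a → τ a' = σ a' := fun a' h => by simp [hτ, h]
  have hprod : ∏ a' ∈ Finset.univ.erase a, w a' (τ a') =
      ∏ a' ∈ Finset.univ.erase a, w a' (σ a') :=
    Finset.prod_congr rfl fun x hx => by rw [hτne x (Finset.ne_of_mem_erase hx)]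
  rw [hprod]
  by_cases h1 : σ a = b
  swap
  · have h2 : τ a ≠ none := by
      rw [hτa, Ne, Equiv.swap_apply_eq_iff, Equiv.swap_apply_right]
      exact h1
    simp [h1, h2]
  by_cases h2 : ∏ a' ∈ Finset.univ.erase a, w a' (σ a') = 0
  · simp [h2]
  have h3 : ∀ x, x ≠ a → σ x ≠ some a := fun x hx hxa =>
    h2 (Finset.prod_eq_zero (Finset.mem_erase.2 ⟨hx, Finset.mem_univ x⟩) (by rw [hxa, hw]))
  have h4 : τ a = none := by rw [hτa, h1, Equiv.swap_apply_left]
  have h5 : σ = Function.update σ a b := by rw [← h1, Function.update_eq_self]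
  have h6 : τ = Function.update σ a none := by
    funext x
    rcases eq_or_ne x a with rfl | hx
    · simp [h4]
    · simp [hx, hτne x hx]
  have h7 : AcyclicMap σ ↔ AcyclicMap τ := by
    rw [h6]
    conv_lhs => rw [h5]
    exact acyclicMap_update_iff h3 hb
  rw [show AcyclicMap σ = AcyclicMap τ from propext h7, h1, h4]
  simp

theorem acyclicSum_of_forall_eq_zero {w : A → Option A → ℚ} {a : A}
    (hw : ∀ a', w a' (some a) = 0) :
    acyclicSum w = (∑ b, w a b) * acyclicSum (Function.update w a (Pi.single none 1)) := by
  have h1 : w = Function.update w a fun b => ∑ i, w a i * (Pi.single i 1 : Option A → ℚ) b := by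
    funext x b
    rcases eq_or_ne x a with rfl | hx
    · simp [Pi.single_apply]
    · simp [hx]
  conv_lhs => rw [h1]
  rw [acyclicSum_update_sum, Finset.sum_mul]
  refine Finset.sum_congr rfl fun b _ => ?_
  rcases eq_or_ne b (some a) with rfl | hb
  · simp [hw]
  · rw [acyclicSum_update_single_of_forall_eq_zero hw hb]

theorem acyclicSum_single_none :
    acyclicSum (fun _ : A => (Pi.single none 1 : Option A → ℚ)) = 1 := by
  unfold acyclicSum
  rw [Fintype.sum_eq_single fun _ => none]
  · have : AcyclicMap fun _ : A => (none : Option A) := ⟨fun _ => 0, by simp⟩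
    simp [this]
  · intro σ hσ
    obtain ⟨a, ha⟩ := Function.ne_iff.1 hσ
    rw [Finset.prod_eq_zero (Finset.mem_univ a)]
    · simp
    · simp [ha]

end AcyclicSum

section Forests

variable {A V : Type*} [Fintype A] [DecidableEq A] [Fintype V] [DecidableEq V]

open Classical in
/-- The acyclic partial maps `f` on `U` such that exactly `c a w` elements of class `a` of `U` are
sent to `w`. -/
noncomputable def forestMaps (cl : V → A) (U : Finset V) (c : A → Option V → ℕ) :
    Finset (V → Option V) :=
  {f | AcyclicMap f ∧ (∀ v, v ∉ U → f v = none) ∧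
    ∀ a w, (U.filter fun v => cl v = a ∧ f v = w).card = c a w}

/-- The sum of `c a w` over all `w` of class `b`. -/
def classWeight (cl : V → A) (c : A → Option V → ℕ) (a : A) (b : Option A) : ℕ :=
  ∑ w : Option V, if w.map cl = b then c a w else 0

/-- `classWeight`, but with the trivial weights in the rows of the empty classes. -/
def rowWeight (cl : V → A) (c : A → Option V → ℕ) (a : A) (b : Option A) : ℚ :=
  if ∑ w, c a w = 0 then (Pi.single none 1 : Option A → ℚ) b else classWeight cl c a b

/-- `c` with the value at `(a, w)` decreased by one. -/
def decr (c : A → Option V → ℕ) (a : A) (w : Option V) : A → Option V → ℕ :=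
  fun a' w' => c a' w' - if a' = a ∧ w' = w then 1 else 0

theorem decr_self (c : A → Option V → ℕ) (a : A) (w : Option V) :
    decr c a w a w = c a w - 1 := by simp [decr]

theorem decr_of_not {c : A → Option V → ℕ} {a a' : A} {w w' : Option V}
    (h : ¬ (a' = a ∧ w' = w)) : decr c a w a' w' = c a' w' := by simp [decr, h]

theorem decr_add {c : A → Option V → ℕ} {a : A} {w : Option V} (h : c a w ≠ 0) (a' : A)
    (w' : Option V) : decr c a w a' w' + (if a' = a ∧ w' = w then 1 else 0) = c a' w' := by
  unfold decr
  split_ifs with h1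
  · obtain ⟨rfl, rfl⟩ := h1
    omega
  · omega

theorem sum_decr {c : A → Option V → ℕ} {a : A} {w : Option V} (h : c a w ≠ 0) (a' : A) :
    ∑ w', decr c a w a' w' + (if a' = a then 1 else 0) = ∑ w', c a' w' := by
  simp_rw [← decr_add h, Finset.sum_add_distrib]
  by_cases h1 : a' = a <;> simp [h1]

theorem prod_factorial_decr {c : A → Option V → ℕ} {a : A} {w : Option V} (h : c a w ≠ 0) :
    ∏ a', ∏ w', ((c a' w')! : ℚ) = c a w * ∏ a', ∏ w', ((decr c a w a' w')! : ℚ) := by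
  simp_rw [← Fintype.prod_prod_type']
  rw [← Finset.mul_prod_erase _ _ (Finset.mem_univ (a, w)),
    ← Finset.mul_prod_erase _ (fun x : A × Option V => ((decr c a w x.1 x.2)! : ℚ))
      (Finset.mem_univ (a, w)), decr_self, ← mul_assoc]
  congr 1
  · exact_mod_cast (Nat.mul_factorial_pred h).symm
  · refine Finset.prod_congr rfl fun x hx => ?_
    rw [decr_of_not fun hx' => Finset.ne_of_mem_erase hx (Prod.ext hx'.1 hx'.2)]

theorem classWeight_decr {c : A → Option V → ℕ} {a : A} {w : Option V} (h : c a w ≠ 0)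
    (cl : V → A) (a' : A) (b : Option A) :
    classWeight cl (decr c a w) a' b + (if a' = a ∧ w.map cl = b then 1 else 0) =
      classWeight cl c a' b := by
  unfold classWeight
  simp_rw [← decr_add h]
  have : ∀ x : Option V, (if x.map cl = b then
      decr c a w a' x + (if a' = a ∧ x = w then 1 else 0) else 0) =
      (if x.map cl = b then decr c a w a' x else 0) +
        if x = w then (if a' = a ∧ w.map cl = b then 1 else 0) else 0 := by
    intro x
    by_cases h1 : x = w
    · subst h1; by_cases h2 : x.map cl = b <;> simp [h2]
    · simp [h1]
  simp_rw [this, Finset.sum_add_distrib]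
  simp

theorem sum_classWeight (cl : V → A) (c : A → Option V → ℕ) (a : A) :
    ∑ b, classWeight cl c a b = ∑ w, c a w := by
  unfold classWeight
  rw [Finset.sum_comm]
  simp

theorem mem_forestMaps_iff_update {cl : V → A} {U : Finset V} {c : A → Option V → ℕ} {v : V}
    (hv : v ∈ U) (hleaf : ∀ a, c a (some v) = 0) {f : V → Option V}
    (hf : c (cl v) (f v) ≠ 0) :
    f ∈ forestMaps cl U c ↔
      Function.update f v none ∈ forestMaps cl (U.erase v) (decr c (cl v) (f v)) := by
  have hcount : ∀ a w, (U.filter fun x => cl x = a ∧ f x = w).card =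
      ((U.erase v).filter fun x => cl x = a ∧ Function.update f v none x = w).card +
        if a = cl v ∧ w = f v then 1 else 0 := by
    intro a w
    have h1 : ((U.erase v).filter fun x => cl x = a ∧ Function.update f v none x = w) =
        (U.erase v).filter fun x => cl x = a ∧ f x = w := by
      refine Finset.filter_congr fun x hx => ?_
      rw [Function.update_of_ne (Finset.ne_of_mem_erase hx)]
    rw [h1, ← Finset.insert_erase hv, Finset.filter_insert, Finset.erase_insert_eq_erase,
      Finset.erase_idem]
    by_cases h2 : cl v = a ∧ f v = w
    · rw [if_pos h2, if_pos ⟨h2.1.symm, h2.2.symm⟩, Finset.card_insert_of_notMem (by simp)]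
    · rw [if_neg h2, if_neg fun h => h2 ⟨h.1.symm, h.2.symm⟩, add_zero]
  have hfv : f v ≠ some v := fun h => hf (by rw [h, hleaf])
  have hkey : (∀ a w, (U.filter fun x => cl x = a ∧ f x = w).card = c a w) ↔
      ∀ a w, ((U.erase v).filter fun x => cl x = a ∧ Function.update f v none x = w).card =
        decr c (cl v) (f v) a w := by
    refine forall_congr' fun a => forall_congr' fun w => ?_
    rw [hcount, ← decr_add hf, add_left_inj]
  have hout : (∀ x, x ∉ U → f x = none) ↔
      ∀ x, x ∉ U.erase v → Function.update f v none x = none := by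
    constructor
    · intro h x hx
      rcases eq_or_ne x v with rfl | hxv
      · simp
      · rw [Function.update_of_ne hxv]
        exact h x fun hxU => hx (Finset.mem_erase.2 ⟨hxv, hxU⟩)
    · intro h x hx
      have hxv : x ≠ v := by rintro rfl; exact hx hv
      simpa [hxv] using h x fun h' => hx (Finset.mem_of_mem_erase h')
  simp only [forestMaps, Finset.mem_filter, Finset.mem_univ, true_and]
  rw [← hkey, ← hout]
  refine and_congr_left ?_
  rintro ⟨h1, h2⟩
  conv_lhs => rw [← Function.update_eq_self v f]
  refine acyclicMap_update_iff (fun x hx hxv => ?_) hfv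
  by_cases hxU : x ∈ U
  · have h3 := h2 (cl x) (some v)
    rw [hleaf, Finset.card_eq_zero] at h3
    exact Finset.notMem_empty x (h3 ▸ Finset.mem_filter.2 ⟨hxU, rfl, hxv⟩)
  · simp [h1 x hxU] at hxv

theorem card_forestMaps_eq_sum {cl : V → A} {U : Finset V} {c : A → Option V → ℕ} {v : V}
    (hv : v ∈ U) (hleaf : ∀ a, c a (some v) = 0) :
    (forestMaps cl U c).card = ∑ w, if c (cl v) w = 0 then 0 else
      (forestMaps cl (U.erase v) (decr c (cl v) w)).card := by
  rw [Finset.card_eq_sum_card_fiberwise (f := fun f : V → Option V => f v)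
    (t := Finset.univ) (fun _ _ => Finset.mem_coe.2 (Finset.mem_univ _))]
  refine Finset.sum_congr rfl fun w _ => ?_
  split_ifs with h0
  · rw [Finset.card_eq_zero, Finset.filter_eq_empty_iff]
    rintro f hf rfl
    simp only [forestMaps, Finset.mem_filter, Finset.mem_univ, true_and] at hf
    have := hf.2.2 (cl v) (f v)
    rw [h0, Finset.card_eq_zero] at this
    exact Finset.notMem_empty v (this ▸ Finset.mem_filter.2 ⟨hv, rfl, rfl⟩)
  · refine Finset.card_nbij' (fun f => Function.update f v none)
      (fun g => Function.update g v w) ?_ ?_ ?_ ?_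
    · intro f hf
      simp only [Finset.coe_filter, Set.mem_ofPred_eq] at hf
      obtain ⟨hf, rfl⟩ := hf
      exact (mem_forestMaps_iff_update hv hleaf h0).1 hf
    · intro g hg
      have hgv : g v = none := by
        simp only [forestMaps, Finset.coe_filter, Finset.mem_univ, true_and,
          Set.mem_ofPred_eq] at hg
        exact hg.2.1 v (by simp)
      simp only [Finset.coe_filter, Set.mem_ofPred_eq, Function.update_self, and_true]
      rw [mem_forestMaps_iff_update hv hleaf (by simpa using h0)]
      rw [Function.update_self, Function.update_idem, ← hgv, Function.update_eq_self]
      exact hg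
    · intro f hf
      simp only [Finset.coe_filter, Set.mem_ofPred_eq] at hf
      simp [← hf.2]
    · intro g hg
      have hgv : g v = none := by
        simp only [forestMaps, Finset.coe_filter, Finset.mem_univ, true_and,
          Set.mem_ofPred_eq] at hg
        exact hg.2.1 v (by simp)
      simp [← hgv]

theorem sum_rowWeight (cl : V → A) (c : A → Option V → ℕ) (a : A) :
    ∑ b, rowWeight cl c a b = if ∑ w, c a w = 0 then 1 else ∑ w, (c a w : ℚ) := by
  unfold rowWeight
  split_ifs
  · simp
  · exact_mod_cast congrArg (Nat.cast : ℕ → ℚ) (sum_classWeight cl c a)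

theorem rowWeight_decr {c : A → Option V → ℕ} {a : A} {w : Option V} (h : c a w ≠ 0)
    (cl : V → A) :
    rowWeight cl (decr c a w) = Function.update (rowWeight cl c) a
      (if ∑ w', c a w' = 1 then Pi.single none 1 else fun b =>
        (classWeight cl c a b : ℚ) - if w.map cl = b then 1 else 0) := by
  funext a' b
  have h1 := sum_decr h a'
  have h2 := classWeight_decr h cl a' b
  rcases eq_or_ne a' a with rfl | ha
  · simp only [if_true, true_and] at h1 h2
    rw [Function.update_self, rowWeight, ← h1]
    by_cases h3 : ∑ w', decr c a' w a' w' = 0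
    · simp [h3]
    · rw [if_neg h3, if_neg (by omega), ← h2]
      push_cast
      ring
  · simp only [ha, if_false, false_and, add_zero] at h1 h2
    rw [Function.update_of_ne ha, rowWeight, rowWeight, h1, h2]

theorem forest_weight_eq_sum {cl : V → A} {U : Finset V} {c : A → Option V → ℕ}
    (hU : ∀ a, (U.filter fun v => cl v = a).card = ∑ w, c a w)
    (hc : ∀ a v, v ∉ U → c a (some v) = 0) {v : V} (hv : v ∈ U)
    (hleaf : ∀ a, c a (some v) = 0) :
    (∏ a, ((∑ w, c a w - 1)! : ℚ)) * acyclicSum (rowWeight cl c) =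
      ∑ w, c (cl v) w * ((∏ a, ((∑ w', decr c (cl v) w a w' - 1)! : ℚ)) *
        acyclicSum (rowWeight cl (decr c (cl v) w))) := by
  set a := cl v with ha
  set m := ∑ w, c a w with hm
  set R := rowWeight cl c with hR
  set Q : ℚ := ∏ a' ∈ Finset.univ.erase a, ((∑ w, c a' w - 1)! : ℚ) with hQ
  have hmpos : 0 < m := by
    rw [hm, ← hU, Finset.card_pos]
    exact ⟨v, Finset.mem_filter.2 ⟨hv, rfl⟩⟩
  have hfac : ∀ w, c a w ≠ 0 →
      ∏ a', ((∑ w', decr c a w a' w' - 1)! : ℚ) = (m - 2)! * Q := by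
    intro w hw
    rw [← Finset.mul_prod_erase _ _ (Finset.mem_univ a)]
    congr 1
    · have := sum_decr hw a
      simp only [if_true] at this
      rw [hm, ← this]
      rfl
    · refine Finset.prod_congr rfl fun a' ha' => ?_
      have := sum_decr hw a'
      rw [if_neg (Finset.ne_of_mem_erase ha'), add_zero] at this
      rw [this]
  have hfac0 : ∏ a', ((∑ w, c a' w - 1)! : ℚ) = (m - 1)! * Q := by
    rw [← Finset.mul_prod_erase _ _ (Finset.mem_univ a)]
  have hrhs : ∀ w, (c a w : ℚ) * ((∏ a', ((∑ w', decr c a w a' w' - 1)! : ℚ)) *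
        acyclicSum (rowWeight cl (decr c a w))) =
      (m - 2)! * Q * (c a w * acyclicSum (Function.update R a
        (if m = 1 then Pi.single none 1 else fun b =>
        (classWeight cl c a b : ℚ) - if w.map cl = b then 1 else 0))) := by
    intro w
    by_cases hw : c a w = 0
    · simp [hw]
    · rw [hfac w hw, rowWeight_decr hw]
      ring
  rw [Finset.sum_congr rfl fun w _ => hrhs w, ← Finset.mul_sum, hfac0]
  by_cases h1 : m = 1
  · have h0 : ∀ a', R a' (some a) = 0 := by
      intro a'
      rw [hR, rowWeight]
      split_ifs with h2
      · simp
      · rw [Nat.cast_eq_zero, classWeight]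
        refine Finset.sum_eq_zero fun w _ => ?_
        split_ifs with h3
        · obtain ⟨x, rfl, hx⟩ := Option.map_eq_some_iff.1 h3
          by_cases hxU : x ∈ U
          · have h4 := hU a
            rw [← hm, h1, Finset.card_eq_one] at h4
            obtain ⟨y, hy⟩ := h4
            have h5 : v ∈ ({y} : Finset V) := hy ▸ Finset.mem_filter.2 ⟨hv, rfl⟩
            have h6 : x ∈ ({y} : Finset V) := hy ▸ Finset.mem_filter.2 ⟨hxU, hx⟩
            rw [Finset.mem_singleton] at h5 h6
            rw [h6, ← h5, hleaf]
          · exact hc _ _ hxU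
        · rfl
    rw [acyclicSum_of_forall_eq_zero h0, hR, sum_rowWeight, ← hm]
    simp only [h1, if_true, one_ne_zero, if_false]
    rw [← Finset.sum_mul, ← Nat.cast_sum, ← hm, h1]
  · simp only [h1, if_false]
    rw [← acyclicSum_update_sum R a Finset.univ (fun w => (c a w : ℚ))]
    have h2 : (fun b => ∑ w, (c a w : ℚ) *
        ((classWeight cl c a b : ℚ) - if w.map cl = b then 1 else 0)) =
        fun b => ∑ _i ∈ ({()} : Finset Unit), ((m : ℚ) - 1) * R a b := by
      funext b
      rw [Finset.sum_singleton, hR, rowWeight, if_neg hmpos.ne']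
      simp_rw [mul_sub, Finset.sum_sub_distrib, ← Finset.sum_mul]
      rw [sub_mul, one_mul, hm, Nat.cast_sum]
      congr 1
      rw [classWeight, Nat.cast_sum]
      exact Finset.sum_congr rfl fun w _ => by split_ifs <;> simp
    rw [h2, acyclicSum_update_sum R a _ (fun _ => (m : ℚ) - 1), Finset.sum_singleton,
      Function.update_eq_self]
    have h3 : ((m - 1)! : ℚ) = ((m : ℚ) - 1) * (m - 2)! := by
      obtain ⟨l, hl⟩ : ∃ l, m = l + 2 := ⟨m - 2, by omega⟩
      rw [hl]
      simp only [Nat.add_sub_cancel, show l + 2 - 1 = l + 1 from rfl, Nat.factorial_succ]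
      push_cast
      ring
    rw [h3]
    ring

theorem forest_weight_eq_zero {cl : V → A} {U : Finset V} {c : A → Option V → ℕ}
    (hU : ∀ a, (U.filter fun v => cl v = a).card = ∑ w, c a w)
    (hc : ∀ a v, v ∉ U → c a (some v) = 0) (hne : U.Nonempty)
    (hleaf : ∀ v ∈ U, ∃ a, c a (some v) ≠ 0) :
    forestMaps cl U c = ∅ ∧ acyclicSum (rowWeight cl c) = 0 := by
  have hcard : U.card = ∑ a, ∑ w, c a w := by
    rw [Finset.card_eq_sum_card_fiberwise (f := cl) (t := Finset.univ)
      (fun _ _ => Finset.mem_coe.2 (Finset.mem_univ _))]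
    exact Finset.sum_congr rfl fun a _ => hU a
  have hsome : U.card ≤ ∑ v : V, ∑ a, c a (some v) := by
    rw [Finset.card_eq_sum_ones]
    calc ∑ _v ∈ U, 1 ≤ ∑ v ∈ U, ∑ a, c a (some v) := by
          refine Finset.sum_le_sum fun v hv => ?_
          obtain ⟨a, ha⟩ := hleaf v hv
          exact (Nat.one_le_iff_ne_zero.2 ha).trans
            (Finset.single_le_sum (f := fun a => c a (some v)) (fun _ _ => Nat.zero_le _)
              (Finset.mem_univ a))
      _ ≤ _ := Finset.sum_le_sum_of_subset (Finset.subset_univ U)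
  have hnone : ∀ a, c a none = 0 := by
    have h1 : ∑ a, c a none = 0 := by
      simp_rw [Fintype.sum_option, Finset.sum_add_distrib] at hcard
      rw [Finset.sum_comm] at hsome
      omega
    exact fun a => Finset.sum_eq_zero_iff.1 h1 a (Finset.mem_univ a)
  constructor
  · rw [Finset.eq_empty_iff_forall_notMem]
    intro f hf
    simp only [forestMaps, Finset.mem_filter, Finset.mem_univ, true_and] at hf
    obtain ⟨hac, -, hcnt⟩ := hf
    obtain ⟨v, hv, hexit⟩ := acyclicMap_exists_exit hac (Z := (· ∈ U)) hne
    have hcv : c (cl v) (f v) ≠ 0 := by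
      rw [← hcnt, ← Nat.pos_iff_ne_zero, Finset.card_pos]
      exact ⟨v, Finset.mem_filter.2 ⟨hv, rfl, rfl⟩⟩
    cases hfv : f v with
    | none => exact hcv (by rw [hfv, hnone])
    | some w => exact hcv (by rw [hfv, hc _ _ (hexit w hfv)])
  · unfold acyclicSum
    refine Finset.sum_eq_zero fun σ _ => ?_
    split_ifs with hac
    · by_contra hprod
      rw [Finset.prod_eq_zero_iff] at hprod
      push Not at hprod
      obtain ⟨v₀, hv₀⟩ := hne
      have hpos : ∀ v ∈ U, ∑ w, c (cl v) w ≠ 0 := by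
        intro v hv
        rw [← hU, ← Nat.pos_iff_ne_zero, Finset.card_pos]
        exact ⟨v, Finset.mem_filter.2 ⟨hv, rfl⟩⟩
      obtain ⟨a, ha, hexit⟩ := acyclicMap_exists_exit hac (Z := fun a => ∑ w, c a w ≠ 0)
        ⟨cl v₀, hpos v₀ hv₀⟩
      have hwt := hprod a (Finset.mem_univ a)
      rw [rowWeight, if_neg ha, Nat.cast_ne_zero, classWeight] at hwt
      obtain ⟨w, -, hw⟩ := Finset.exists_ne_zero_of_sum_ne_zero hwt
      rw [ite_ne_right_iff] at hw
      cases w with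
      | none => exact hw.2 (hnone a)
      | some x =>
        by_cases hx : x ∈ U
        · exact hexit (cl x) hw.1.symm (hpos x hx)
        · exact hw.2 (hc a x hx)
    · rfl

/-- The number of acyclic partial maps with prescribed numbers of elements of each class in each
fibre. -/
theorem card_forestMaps (cl : V → A) (U : Finset V) (c : A → Option V → ℕ)
    (hU : ∀ a, (U.filter fun v => cl v = a).card = ∑ w, c a w)
    (hc : ∀ a v, v ∉ U → c a (some v) = 0) :
    ((forestMaps cl U c).card : ℚ) * ∏ a, ∏ w, ((c a w)! : ℚ) =
      (∏ a, ((∑ w, c a w - 1)! : ℚ)) * acyclicSum (rowWeight cl c) := by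
  induction U using Finset.strongInduction generalizing c with
  | H U ih =>
  rcases U.eq_empty_or_nonempty with rfl | hne
  · have h0 : ∀ a, ∑ w, c a w = 0 := fun a => by simpa using (hU a).symm
    have h1 : ∀ a w, c a w = 0 := fun a w =>
      Finset.sum_eq_zero_iff.1 (h0 a) w (Finset.mem_univ w)
    have h2 : forestMaps cl ∅ c = {fun _ => none} := by
      ext f
      simp only [forestMaps, Finset.mem_filter, Finset.mem_univ, true_and,
        Finset.mem_singleton, Finset.notMem_empty, not_false_eq_true, forall_true_left,
        Finset.filter_empty, Finset.card_empty, h1, implies_true, and_true]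
      constructor
      · exact fun h => funext h.2
      · rintro rfl
        exact ⟨⟨fun _ => 0, by simp⟩, fun _ => rfl⟩
    have h3 : rowWeight cl c = fun _ => Pi.single none 1 := by
      funext a b
      simp [rowWeight, h0]
    rw [h2, h3, acyclicSum_single_none]
    simp [h1]
  by_cases hleaf : ∃ v ∈ U, ∀ a, c a (some v) = 0
  · obtain ⟨v, hv, hleaf⟩ := hleaf
    rw [forest_weight_eq_sum hU hc hv hleaf, card_forestMaps_eq_sum hv hleaf, Nat.cast_sum,
      Finset.sum_mul]
    refine Finset.sum_congr rfl fun w _ => ?_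
    split_ifs with h0
    · simp [h0]
    rw [← ih (U.erase v) (Finset.erase_ssubset hv) (decr c (cl v) w), prod_factorial_decr h0]
    · ring
    · intro a
      have h1 := sum_decr h0 a
      rw [← hU] at h1
      rw [Finset.filter_erase]
      by_cases h2 : a = cl v
      · rw [Finset.card_erase_of_mem (Finset.mem_filter.2 ⟨hv, h2.symm⟩)]
        rw [if_pos h2] at h1
        omega
      · rw [Finset.erase_eq_of_notMem
          (fun h => h2 (Finset.mem_filter.1 h).2.symm)]
        rw [if_neg h2] at h1
        omega
    · intro a x hx
      have h1 : c a (some x) = 0 := by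
        rcases eq_or_ne x v with rfl | hxv
        · exact hleaf a
        · exact hc a x fun h => hx (Finset.mem_erase.2 ⟨hxv, h⟩)
      simp [decr, h1]
  · push Not at hleaf
    obtain ⟨h1, h2⟩ := forest_weight_eq_zero hU hc hne hleaf
    simp [h1, h2]

end Forests
namespace RootedTree

variable {d : ℕ} {n : Fin d → ℕ}

theorem isChild_unique (T : RootedTree n) {v p q : Vertex n} (hp : T.IsChild v p)
    (hq : T.IsChild v q) : p = q := by
  have key : ∀ {p : Vertex n}, T.IsChild v p →
      ∃ W : T.graph.Walk p T.root, ∃ h : T.graph.Adj v p, (SimpleGraph.Walk.cons h W).IsPath := by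
    intro p hp
    obtain ⟨W, hW⟩ := T.isTree.connected.exists_walk_length_eq_dist p T.root
    refine ⟨W, hp.1, SimpleGraph.Walk.isPath_of_length_eq_dist _ ?_⟩
    rw [SimpleGraph.Walk.length_cons, hW, hp.2]
  obtain ⟨W, h, hW⟩ := key hp
  obtain ⟨W', h', hW'⟩ := key hq
  have h1 := (T.isTree.existsUnique_path v T.root).unique hW hW'
  have h2 := congrArg SimpleGraph.Walk.snd h1
  simpa using h2

theorem exists_isChild (T : RootedTree n) {v : Vertex n} (hv : v ≠ T.root) :
    ∃ p, T.IsChild v p := by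
  obtain ⟨W, hW⟩ := T.isTree.connected.exists_walk_length_eq_dist v T.root
  cases W with
  | nil => exact absurd rfl hv
  | cons h W =>
    rename_i p
    refine ⟨p, h, ?_⟩
    rw [SimpleGraph.Walk.length_cons] at hW
    have h1 := SimpleGraph.dist_le W
    rcases T.isTree.dist_eq_dist_add_one_of_adj T.root h with h2 | h2 <;>
      simp only [SimpleGraph.dist_comm (u := T.root)] at h2 <;> omega

theorem not_isChild_root (T : RootedTree n) (p : Vertex n) : ¬ T.IsChild T.root p := by
  rintro ⟨-, h⟩
  simp at h

theorem adj_iff_isChild (T : RootedTree n) (v w : Vertex n) :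
    T.graph.Adj v w ↔ T.IsChild v w ∨ T.IsChild w v := by
  constructor
  · intro h
    rcases T.isTree.dist_eq_dist_add_one_of_adj T.root h with h2 | h2 <;>
      simp only [SimpleGraph.dist_comm (u := T.root)] at h2
    · exact Or.inl ⟨h, h2⟩
    · exact Or.inr ⟨h.symm, h2⟩
  · rintro (h | h)
    · exact h.1
    · exact h.1.symm

open Classical in
/-- The map sending each vertex to its parent, and the root to `none`. -/
noncomputable def parentMap (T : RootedTree n) (v : Vertex n) : Option (Vertex n) :=
  if h : ∃ p, T.IsChild v p then some h.choose else none

theorem parentMap_eq_some_iff (T : RootedTree n) {v p : Vertex n} :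
    T.parentMap v = some p ↔ T.IsChild v p := by
  unfold parentMap
  split_ifs with h
  · rw [Option.some_inj]
    exact ⟨fun hp => hp ▸ h.choose_spec, fun hp => T.isChild_unique h.choose_spec hp⟩
  · exact ⟨fun hp => by simp at hp, fun hp => absurd ⟨p, hp⟩ h⟩

theorem parentMap_eq_none_iff (T : RootedTree n) {v : Vertex n} :
    T.parentMap v = none ↔ v = T.root := by
  constructor
  · intro h
    by_contra hv
    obtain ⟨p, hp⟩ := T.exists_isChild hv
    simp [T.parentMap_eq_some_iff.2 hp] at h
  · rintro rfl
    unfold parentMap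
    exact dif_neg fun ⟨p, hp⟩ => T.not_isChild_root p hp

theorem acyclicMap_parentMap (T : RootedTree n) : AcyclicMap T.parentMap := by
  refine ⟨fun v => T.graph.dist v T.root, fun v w h => ?_⟩
  exact (Nat.lt_succ_self _).trans_eq (T.parentMap_eq_some_iff.1 h).2.symm

theorem parentMap_injective :
    Function.Injective (parentMap : RootedTree n → Vertex n → Option (Vertex n)) := by
  intro T T' h
  refine RootedTree.ext (SimpleGraph.ext (funext₂ fun v w => propext ?_)) ?_
  · rw [adj_iff_isChild, adj_iff_isChild, ← parentMap_eq_some_iff, ← parentMap_eq_some_iff,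
      ← parentMap_eq_some_iff, ← parentMap_eq_some_iff, h]
  · rw [← T'.parentMap_eq_none_iff, ← h, T.parentMap_eq_none_iff]

theorem exists_parentMap_eq {f : Vertex n → Option (Vertex n)} (hf : AcyclicMap f)
    {r : Vertex n} (hr : ∀ v, f v = none ↔ v = r) : ∃ T : RootedTree n, T.parentMap = f := by
  classical
  obtain ⟨h, hh⟩ := hf
  have hsome : ∀ v, v ≠ r → ∃ w, f v = some w := fun v hv =>
    Option.ne_none_iff_exists'.1 fun h0 => hv ((hr v).1 h0)
  let G : SimpleGraph (Vertex n) := SimpleGraph.fromRel fun v w => f v = some w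
  have hadj : ∀ v w, G.Adj v w ↔ f v = some w ∨ f w = some v := by
    intro v w
    rw [SimpleGraph.fromRel_adj]
    refine ⟨fun h0 => h0.2, fun h0 => ⟨?_, h0⟩⟩
    rintro rfl
    exact lt_irrefl _ (hh v v (or_self_iff.1 h0))
  have hreach : ∀ m v, h v = m → G.Reachable v r := by
    intro m
    induction m using Nat.strong_induction_on with
    | _ m ih =>
      intro v hv
      by_cases hvr : v = r
      · rw [hvr]
      · obtain ⟨w, hw⟩ := hsome v hvr
        have h1 : G.Adj v w := (hadj v w).2 (Or.inl hw)
        exact h1.reachable.trans (ih (h w) (hv ▸ hh v w hw) w rfl)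
  have hconn : G.Connected :=
    { preconnected := fun v w => (hreach _ v rfl).trans (hreach _ w rfl).symm
      nonempty := ⟨r⟩ }
  have hcard : Nat.card G.edgeSet + 1 ≤ Nat.card (Vertex n) := by
    let g : {v : Vertex n // v ≠ r} → G.edgeSet := fun v =>
      ⟨s(v.1, (hsome v.1 v.2).choose),
        (hadj _ _).2 (Or.inl (hsome v.1 v.2).choose_spec)⟩
    have hg : Function.Surjective g := by
      have key : ∀ v w (hvw : f v = some w), ∃ x, (g x).1 = s(v, w) := by
        intro v w hvw
        have hv : v ≠ r := fun h0 => by simp [(hr v).2 h0] at hvw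
        refine ⟨⟨v, hv⟩, ?_⟩
        have := (hsome v hv).choose_spec
        have hw : (hsome v hv).choose = w := Option.some_inj.1 (this.symm.trans hvw)
        simp only [g, hw]
      rintro ⟨e, he⟩
      induction e with
      | _ v w =>
        rcases (hadj v w).1 he with h0 | h0
        · obtain ⟨x, hx⟩ := key v w h0
          exact ⟨x, Subtype.ext hx⟩
        · obtain ⟨x, hx⟩ := key w v h0
          exact ⟨x, Subtype.ext (hx.trans Sym2.eq_swap)⟩
    have h1 := Nat.card_le_card_of_surjective g hg
    have h2 : Nat.card {v : Vertex n // v ≠ r} + 1 = Nat.card (Vertex n) := by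
      rw [Nat.card_eq_fintype_card, Nat.card_eq_fintype_card, Fintype.card_subtype_compl,
        Fintype.card_subtype_eq]
      have := Fintype.card_pos_iff.2 ⟨r⟩
      omega
    omega
  have htree : G.IsTree := SimpleGraph.isTree_iff_connected_and_card.2
    ⟨hconn, le_antisymm hcard hconn.card_vert_le_card_edgeSet_add_one⟩
  let T : RootedTree n := ⟨G, htree, r⟩
  have hchild : ∀ m v w, h v = m → f v = some w → T.IsChild v w := by
    intro m
    induction m using Nat.strong_induction_on with
    | _ m ih =>
      intro v w hv hw
      have h1 : T.graph.Adj v w := (hadj v w).2 (Or.inl hw)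
      refine ((T.adj_iff_isChild v w).1 h1).resolve_right fun h2 => ?_
      have hwr : w ≠ r := fun h0 => T.not_isChild_root v (by rwa [h0] at h2)
      obtain ⟨x, hx⟩ := hsome w hwr
      have h3 := hh v w hw
      obtain rfl := T.isChild_unique h2 (ih (h w) (hv ▸ h3) w x rfl hx)
      exact absurd (hh w v hx) h3.not_gt
  refine ⟨T, funext fun v => ?_⟩
  by_cases hv : v = r
  · rw [(hr v).2 hv]
    exact T.parentMap_eq_none_iff.2 hv
  · obtain ⟨w, hw⟩ := hsome v hv
    rw [hw]
    exact T.parentMap_eq_some_iff.2 (hchild _ v w rfl hw)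

end RootedTree
section StepClasses

variable {k : ℕ}

/-- A vertex class: the type of a vertex together with the type of its parent. -/
abbrev VertexClass (k : ℕ) : Type := Fin (k + 1) × Fin (k + 1 + 1)

/-- The class `(s, s)`. -/
def diagClass (s : Fin (k + 1)) : VertexClass k := (s, s.castSucc)

/-- The class `(j, j + 1)`. -/
def stepClass (j : Fin k) : VertexClass k := (j.castSucc, j.succ.castSucc)

/-- The class `(j + 1, j + 2)`. -/
def nextClass (j : Fin k) : VertexClass k := (j.succ, j.succ.succ)

/-- The class weights of a profile with numbers `q s t v` of edges from vertices of type `s` to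
vertices of class `(t, v)`, and a root of the last type. -/
def stepWeight (q : Fin (k + 1) → Fin (k + 1) → Fin (k + 1 + 1) → ℕ) (a : VertexClass k) :
    Option (VertexClass k) → ℕ
  | none => if a.2 = Fin.last (k + 1) ∧ a.1 = Fin.last k then 1 else 0
  | some b => if a.2 = b.1.castSucc then q a.1 b.1 b.2 else 0

/-- Class weights, with the trivial weights in the rows of the empty classes. -/
def stepRow (m : VertexClass k → ℕ) (q : Fin (k + 1) → Fin (k + 1) → Fin (k + 1 + 1) → ℕ)
    (a : VertexClass k) (b : Option (VertexClass k)) : ℚ :=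
  if m a = 0 then (Pi.single none 1 : Option (VertexClass k) → ℚ) b else stepWeight q a b

/-- The conditions that single out the acyclic maps of nonzero weight. -/
def Ascending (σ : VertexClass k → Option (VertexClass k)) : Prop :=
  (∀ s, σ (diagClass s) ≠ some (diagClass s)) ∧
    ∀ j, σ (stepClass j) = some (nextClass j) ∨
      (σ (stepClass j) = some (diagClass j.succ) ∧ σ (diagClass j.succ) = some (nextClass j))

variable {m : VertexClass k → ℕ} {q : Fin (k + 1) → Fin (k + 1) → Fin (k + 1 + 1) → ℕ}
  {σ : VertexClass k → Option (VertexClass k)}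

theorem eq_none_of_stepRow_ne_zero (hσ : ∀ a, stepRow m q a (σ a) ≠ 0) {a : VertexClass k}
    (ha : m a = 0) : σ a = none := by
  by_contra h
  exact hσ a (by simp [stepRow, ha, h])

theorem stepRow_some_ne_zero (hσ : ∀ a, stepRow m q a (σ a) ≠ 0)
    (hq : ∀ s t v, q s t v ≠ 0 → m (t, v) ≠ 0) {a b : VertexClass k} (hab : σ a = some b) :
    m a ≠ 0 ∧ m b ≠ 0 ∧ (a.2 : ℕ) = b.1 := by
  have ha : m a ≠ 0 := fun h => by simp [eq_none_of_stepRow_ne_zero hσ h] at hab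
  have h1 := hσ a
  rw [hab, stepRow, if_neg ha, Nat.cast_ne_zero] at h1
  simp only [stepWeight, ne_eq, ite_eq_right_iff, Classical.not_imp] at h1
  exact ⟨ha, hq _ _ _ h1.2, by rw [h1.1]; rfl⟩

theorem exists_eq_some_of_stepRow_ne_zero (hσ : ∀ a, stepRow m q a (σ a) ≠ 0)
    {a : VertexClass k} (ha : m a ≠ 0) (hlast : (a.2 : ℕ) ≠ k + 1) : ∃ b, σ a = some b := by
  rw [← Option.ne_none_iff_exists']
  intro h
  have h1 := hσ a
  rw [h, stepRow, if_neg ha, Nat.cast_ne_zero] at h1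
  simp only [stepWeight, ne_eq, ite_eq_right_iff, Classical.not_imp] at h1
  exact hlast (by rw [h1.1.1]; rfl)

theorem exists_exit_of_stepRow_ne_zero (hσ : ∀ a, stepRow m q a (σ a) ≠ 0)
    (hq : ∀ s t v, q s t v ≠ 0 → m (t, v) ≠ 0) (hac : AcyclicMap σ) (P : VertexClass k → Prop)
    (hP : ∀ a, P a → m a ≠ 0 → (a.2 : ℕ) ≠ k + 1) (hne : ∃ a, P a ∧ m a ≠ 0) :
    ∃ a b, P a ∧ m a ≠ 0 ∧ σ a = some b ∧ ¬ P b ∧ (a.2 : ℕ) = b.1 := by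
  obtain ⟨a, ⟨ha, hma⟩, hexit⟩ := acyclicMap_exists_exit hac hne
  obtain ⟨b, hb⟩ := exists_eq_some_of_stepRow_ne_zero hσ hma (hP a ha hma)
  obtain ⟨-, h1, h2⟩ := stepRow_some_ne_zero hσ hq hb
  exact ⟨a, b, ha, hma, hb, fun h => hexit b hb ⟨h, h1⟩, h2⟩

theorem eq_stepClass {a : VertexClass k} {j : Fin k} (h1 : (a.1 : ℕ) = j)
    (h2 : (a.2 : ℕ) = j + 1) : a = stepClass j :=
  Prod.ext (Fin.ext h1) (Fin.ext h2)

theorem eq_diagClass {a : VertexClass k} {s : Fin (k + 1)} (h1 : (a.1 : ℕ) = s)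
    (h2 : (a.2 : ℕ) = s) : a = diagClass s :=
  Prod.ext (Fin.ext h1) (Fin.ext h2)

theorem eq_nextClass {a : VertexClass k} {j : Fin k} (h1 : (a.1 : ℕ) = j + 1)
    (h2 : (a.2 : ℕ) = j + 2) : a = nextClass j :=
  Prod.ext (Fin.ext h1) (Fin.ext h2)

theorem ascending_of_acyclicMap (hσ : ∀ a, stepRow m q a (σ a) ≠ 0)
    (hq : ∀ s t v, q s t v ≠ 0 → m (t, v) ≠ 0)
    (hstep : ∀ a, m a ≠ 0 → (a.2 : ℕ) ≤ a.1 + 1) (hpos : ∀ s, ∃ t, m (s, t) ≠ 0)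
    (hac : AcyclicMap σ) : Ascending σ := by
  have hself : ∀ a, σ a ≠ some a := by
    obtain ⟨h, hh⟩ := hac
    exact fun a ha => lt_irrefl _ (hh a a ha)
  refine ⟨fun s => hself _, fun j => ?_⟩
  have hj := j.isLt
  have hm : m (stepClass j) ≠ 0 := by
    intro h0
    obtain ⟨t, ht⟩ := hpos j.castSucc
    obtain ⟨a, b, ha, hma, hab, hb, h2⟩ := exists_exit_of_stepRow_ne_zero hσ hq hac
      (fun a => (a.1 : ℕ) ≤ j)
      (fun a ha hma => by have := hstep a hma; omega) ⟨(j.castSucc, t), by simp, ht⟩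
    have h3 := hstep a hma
    rw [eq_stepClass (a := a) (j := j) (by omega) (by omega)] at hma
    exact hma h0
  obtain ⟨b, hb⟩ := exists_eq_some_of_stepRow_ne_zero hσ hm (by simp [stepClass]; omega)
  obtain ⟨-, hmb, hb1⟩ := stepRow_some_ne_zero hσ hq hb
  have hb1 : (b.1 : ℕ) = j + 1 := hb1.symm
  have hb2 := hstep b hmb
  by_cases hlow : (b.2 : ℕ) ≤ j
  · exfalso
    obtain ⟨a, c, ha, hma, hac, hc, h2⟩ := exists_exit_of_stepRow_ne_zero hσ hq hac
      (fun a => (a.1 : ℕ) ≤ j ∨ ((a.1 : ℕ) = j + 1 ∧ (a.2 : ℕ) ≤ j))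
      (fun a ha hma => by have := hstep a hma; omega) ⟨b, Or.inr ⟨hb1, hlow⟩, hmb⟩
    have h3 := hstep a hma
    by_cases h4 : (a.1 : ℕ) = j ∧ (a.2 : ℕ) = j + 1
    · rw [eq_stepClass h4.1 h4.2, hb, Option.some_inj] at hac
      subst hac
      omega
    · omega
  by_cases htop : (b.2 : ℕ) = j + 2
  · exact Or.inl (by rw [hb, eq_nextClass hb1 htop])
  obtain rfl : b = diagClass j.succ := eq_diagClass hb1 (by simp; omega)
  refine Or.inr ⟨hb, ?_⟩
  obtain ⟨c, hc⟩ := exists_eq_some_of_stepRow_ne_zero hσ hmb (by simp [diagClass]; omega)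
  obtain ⟨-, hmc, hc1⟩ := stepRow_some_ne_zero hσ hq hc
  have hc1 : (c.1 : ℕ) = j + 1 := hc1.symm
  have hc2 := hstep c hmc
  by_cases hctop : (c.2 : ℕ) = j + 2
  · rw [hc, eq_nextClass hc1 hctop]
  exfalso
  have hcd : (c.2 : ℕ) ≠ j + 1 := fun h => by
    rw [eq_diagClass (s := j.succ) hc1 h] at hc
    exact hself _ hc
  obtain ⟨a, e, ha, hma, hae, he, h2⟩ := exists_exit_of_stepRow_ne_zero hσ hq hac
    (fun a => (a.1 : ℕ) ≤ j ∨ ((a.1 : ℕ) = j + 1 ∧ (a.2 : ℕ) ≤ j + 1))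
    (fun a ha hma => by have := hstep a hma; omega) ⟨c, Or.inr ⟨hc1, by omega⟩, hmc⟩
  have h3 := hstep a hma
  by_cases h4 : (a.1 : ℕ) = j ∧ (a.2 : ℕ) = j + 1
  · rw [eq_stepClass h4.1 h4.2, hb, Option.some_inj] at hae
    subst hae
    simp [diagClass] at he
  by_cases h5 : (a.1 : ℕ) = j + 1 ∧ (a.2 : ℕ) = j + 1
  · rw [eq_diagClass (s := j.succ) h5.1 h5.2, hc, Option.some_inj] at hae
    subst hae
    omega
  · omega

theorem acyclicMap_of_ascending (hσ : ∀ a, stepRow m q a (σ a) ≠ 0)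
    (hq : ∀ s t v, q s t v ≠ 0 → m (t, v) ≠ 0)
    (hstep : ∀ a, m a ≠ 0 → (a.2 : ℕ) ≤ a.1 + 1) (hgood : Ascending σ) : AcyclicMap σ := by
  refine ⟨fun a => if (a.2 : ℕ) < a.1 then 2 * (k + 2) + 2 * a.1 else
    if (a.2 : ℕ) = a.1 then
      if σ a = some (a.1, a.1.succ) then 2 * (k + 1 - a.1) + 1 else 2 * (k + 2) + 2 * a.1 + 1
    else 2 * (k + 1 - a.1), fun a b hab => ?_⟩
  obtain ⟨hma, hmb, h1⟩ := stepRow_some_ne_zero hσ hq hab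
  have ha := hstep a hma
  have hb := hstep b hmb
  have ha1 := a.1.isLt
  have hb1 := b.1.isLt
  have htop : (a.1 : ℕ) = b.1 → (b.2 : ℕ) = b.1 + 1 → b = (a.1, a.1.succ) := fun h2 h3 =>
    Prod.ext (Fin.ext h2.symm) (Fin.ext (by simp; omega))
  beta_reduce
  rcases lt_trichotomy (a.2 : ℕ) a.1 with h2 | h2 | h2
  · rw [if_pos h2]
    split_ifs <;> omega
  · rw [if_neg h2.not_lt, if_pos h2]
    have hne : b ≠ diagClass a.1 := by
      rintro rfl
      refine hgood.1 a.1 ?_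
      conv_lhs => rw [← eq_diagClass (a := a) rfl h2]
      exact hab
    have hb2 : (b.2 : ℕ) ≠ b.1 := fun h => hne (eq_diagClass (by omega) (by omega))
    rw [if_neg hb2]
    by_cases h3 : σ a = some (a.1, a.1.succ)
    · rw [if_pos h3]
      have h4 : b = (a.1, a.1.succ) := Option.some_inj.1 (hab.symm.trans h3)
      have h5 : (b.2 : ℕ) = a.1 + 1 := by rw [h4]; rfl
      rw [if_neg (show ¬ (b.2 : ℕ) < b.1 by omega)]
      omega
    · rw [if_neg h3]
      rw [hab, Option.some_inj] at h3
      split_ifs <;> omega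
  · rw [if_neg h2.not_gt, if_neg h2.ne']
    have hj : (a.1 : ℕ) < k := by omega
    have haj : a = stepClass ⟨a.1, hj⟩ := eq_stepClass rfl (by simp; omega)
    rcases hgood.2 ⟨a.1, hj⟩ with h3 | ⟨h3, h4⟩
    · rw [← haj, hab, Option.some_inj] at h3
      have h5 : (b.2 : ℕ) = a.1 + 2 := by rw [h3]; rfl
      rw [if_neg (show ¬ (b.2 : ℕ) < b.1 by omega), if_neg (show ¬ (b.2 : ℕ) = b.1 by omega)]
      omega
    · rw [← haj, hab, Option.some_inj] at h3
      have h5 : (b.2 : ℕ) = a.1 + 1 := by rw [h3]; rfl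
      have h6 : σ b = some (b.1, b.1.succ) := by rw [h3, h4]; rfl
      rw [if_neg (show ¬ (b.2 : ℕ) < b.1 by omega), if_pos (show (b.2 : ℕ) = b.1 by omega),
        if_pos h6]
      omega

/-- The values allowed by the choice `J`, which tells for each `j` whether the class `(j, j + 1)`
is sent to `(j + 1, j + 2)` directly. -/
def Allowed (J : Fin k → Bool) (a : VertexClass k) (b : Option (VertexClass k)) : Prop :=
  (∀ s, a = diagClass s → b ≠ some (diagClass s)) ∧
    ∀ j, (a = stepClass j → b = if J j then some (nextClass j) else some (diagClass j.succ)) ∧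
      (a = diagClass j.succ → J j = false → b = some (nextClass j))

theorem nextClass_ne_diagClass (j : Fin k) : nextClass j ≠ diagClass j.succ := by
  intro h
  simp [nextClass, diagClass, Fin.ext_iff] at h

theorem ascending_iff_exists_allowed :
    Ascending σ ↔ ∃ J : Fin k → Bool, ∀ a, Allowed J a (σ a) := by
  classical
  constructor
  · rintro ⟨h1, h2⟩
    refine ⟨fun j => decide (σ (stepClass j) = some (nextClass j)), fun a => ⟨?_, fun j => ⟨?_, ?_⟩⟩⟩
    · rintro s rfl
      exact h1 s
    · rintro rfl
      rcases h2 j with h | h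
      · simp [h]
      · simp [h.1, (nextClass_ne_diagClass j).symm]
    · rintro rfl hJ
      exact ((h2 j).resolve_left (by simpa using hJ)).2
  · rintro ⟨J, hJ⟩
    refine ⟨fun s => (hJ _).1 s rfl, fun j => ?_⟩
    have h1 := ((hJ (stepClass j)).2 j).1 rfl
    have h2 := ((hJ (diagClass j.succ)).2 j).2 rfl
    cases hb : J j
    · exact Or.inr ⟨by simpa [hb] using h1, h2 hb⟩
    · exact Or.inl (by simpa [hb] using h1)

theorem allowed_unique {J J' : Fin k → Bool} (h : ∀ a, Allowed J a (σ a))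
    (h' : ∀ a, Allowed J' a (σ a)) : J = J' := by
  funext j
  have h1 := ((h (stepClass j)).2 j).1 rfl
  rw [((h' (stepClass j)).2 j).1 rfl] at h1
  have h2 := nextClass_ne_diagClass j
  cases hb : J j <;> cases hb' : J' j <;> simp [hb, hb', h2, h2.symm] at h1 ⊢

open Classical in
theorem acyclicSum_stepRow_eq_sum (hq : ∀ s t v, q s t v ≠ 0 → m (t, v) ≠ 0)
    (hstep : ∀ a, m a ≠ 0 → (a.2 : ℕ) ≤ a.1 + 1) (hpos : ∀ s, ∃ t, m (s, t) ≠ 0) :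
    acyclicSum (stepRow m q) =
      ∑ J : Fin k → Bool, ∏ a, ∑ b, if Allowed J a b then stepRow m q a b else 0 := by
  have h1 : ∀ σ : VertexClass k → Option (VertexClass k),
      (if AcyclicMap σ then ∏ a, stepRow m q a (σ a) else 0) =
        ∑ J : Fin k → Bool, ∏ a, if Allowed J a (σ a) then stepRow m q a (σ a) else 0 := by
    intro σ
    by_cases hσ : ∀ a, stepRow m q a (σ a) ≠ 0
    · by_cases hgood : Ascending σ
      · rw [if_pos (acyclicMap_of_ascending hσ hq hstep hgood)]
        obtain ⟨J, hJ⟩ := ascending_iff_exists_allowed.1 hgood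
        rw [Fintype.sum_eq_single J]
        · exact Finset.prod_congr rfl fun a _ => (if_pos (hJ a)).symm
        · intro J' hJ'
          by_contra hne
          rw [← ne_eq, Finset.prod_ne_zero_iff] at hne
          refine hJ' (allowed_unique (σ := σ) (fun a => ?_) hJ)
          by_contra h
          exact hne a (Finset.mem_univ a) (if_neg h)
      · rw [if_neg fun hac => hgood (ascending_of_acyclicMap hσ hq hstep hpos hac)]
        symm
        refine Finset.sum_eq_zero fun J _ => ?_
        by_contra hne
        rw [← ne_eq, Finset.prod_ne_zero_iff] at hne
        refine hgood (ascending_iff_exists_allowed.2 ⟨J, fun a => ?_⟩)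
        by_contra h
        exact hne a (Finset.mem_univ a) (if_neg h)
    · push Not at hσ
      obtain ⟨a, ha⟩ := hσ
      rw [Finset.prod_eq_zero (Finset.mem_univ a) ha, ite_self]
      symm
      exact Finset.sum_eq_zero fun J _ => Finset.prod_eq_zero (Finset.mem_univ a) (by simp [ha])
  unfold acyclicSum
  rw [Finset.sum_congr rfl fun σ _ => h1 σ, Finset.sum_comm]
  refine Finset.sum_congr rfl fun J _ => ?_
  rw [Finset.prod_univ_sum, Fintype.piFinset_univ]

/-- The sum of the nontrivial weights of `(s, s)`. -/
def loopFree (m : VertexClass k → ℕ) (q : Fin (k + 1) → Fin (k + 1) → Fin (k + 1 + 1) → ℕ)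
    (s : Fin (k + 1)) : ℚ :=
  if 0 < m (diagClass s) then (m (diagClass s) : ℚ) - q s s s.castSucc else 1

theorem sum_stepRow (hm : ∀ a, m a = ∑ b, stepWeight q a b) (a : VertexClass k) :
    ∑ b, stepRow m q a b = if 0 < m a then (m a : ℚ) else 1 := by
  unfold stepRow
  rcases Nat.eq_zero_or_pos (m a) with h | h
  · simp [h]
  · simp only [h.ne', h, if_true, if_false]
    rw [hm a, Nat.cast_sum]

theorem sum_stepRow_diagClass (hm : ∀ a, m a = ∑ b, stepWeight q a b) (s : Fin (k + 1)) :
    ∑ b, (if b ≠ some (diagClass s) then stepRow m q (diagClass s) b else 0) =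
      loopFree m q s := by
  have h1 : ∑ b, (if b ≠ some (diagClass s) then stepRow m q (diagClass s) b else 0) =
      ∑ b, stepRow m q (diagClass s) b - stepRow m q (diagClass s) (some (diagClass s)) := by
    rw [eq_sub_iff_add_eq, ← Finset.sum_filter, Finset.filter_ne', Finset.sum_erase_add]
    exact Finset.mem_univ _
  rw [h1, sum_stepRow hm, loopFree]
  rcases Nat.eq_zero_or_pos (m (diagClass s)) with h | h
  · simp [h, stepRow]
  · simp only [h, if_true, stepRow, h.ne', if_false, stepWeight]
    simp [diagClass]

theorem stepRow_some_of_castSucc (hm : ∀ a, m a = ∑ b, stepWeight q a b)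
    (s t : Fin (k + 1)) (v : Fin (k + 1 + 1)) :
    stepRow m q (s, t.castSucc) (some (t, v)) = q s t v := by
  have h1 : stepWeight q (s, t.castSucc) (some (t, v)) = q s t v := by simp [stepWeight]
  rcases eq_or_ne (m (s, t.castSucc)) 0 with h | h
  · have h2 : q s t v = 0 := by
      rw [hm] at h
      rw [← h1]
      exact Finset.sum_eq_zero_iff.1 h _ (Finset.mem_univ _)
    simp [stepRow, h, h2]
  · rw [stepRow, if_neg h, h1]

open Classical in
theorem sum_allowed (hm : ∀ a, m a = ∑ b, stepWeight q a b)
    (hstep : ∀ a, m a ≠ 0 → (a.2 : ℕ) ≤ a.1 + 1) (J : Fin k → Bool) (s : Fin (k + 1))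
    (t : Fin (k + 1 + 1)) :
    (∑ b, if Allowed J (s, t) b then stepRow m q (s, t) b else 0) =
      (if (t : ℕ) < s ∧ 0 < m (s, t) then (m (s, t) : ℚ) else 1) *
      (if t = s.castSucc then (Fin.cases (loopFree m q 0) (fun j => if J j then
        loopFree m q j.succ else (q j.succ j.succ j.succ.succ : ℚ)) s : ℚ) else 1) *
      (if t = s.succ then (Fin.lastCases 1 (fun j => if J j then
        (q j.castSucc j.succ j.succ.succ : ℚ) else q j.castSucc j.succ j.succ.castSucc) s : ℚ)
        else 1) := by
  have hdiag : ∀ s', ((s, t) = diagClass s') ↔ s' = s ∧ t = s.castSucc := by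
    intro s'
    simp only [diagClass, Prod.mk.injEq]
    constructor
    · rintro ⟨rfl, rfl⟩; exact ⟨rfl, rfl⟩
    · rintro ⟨rfl, rfl⟩; exact ⟨rfl, rfl⟩
  have hsc : ∀ j : Fin k, ((s, t) = stepClass j) ↔ s = j.castSucc ∧ t = s.succ := by
    intro j
    simp only [stepClass, Prod.mk.injEq]
    constructor
    · rintro ⟨rfl, rfl⟩; exact ⟨rfl, rfl⟩
    · rintro ⟨rfl, rfl⟩; exact ⟨rfl, rfl⟩
  by_cases h1 : t = s.castSucc
  · subst h1
    have hne : s.castSucc ≠ s.succ := by simp [Fin.ext_iff]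
    have hall : ∀ b, Allowed J (s, s.castSucc) b ↔ b ≠ some (diagClass s) ∧
        ∀ j : Fin k, s = j.succ → J j = false → b = some (nextClass j) := by
      intro b
      simp only [Allowed, hdiag, hsc, hne, and_true, and_false, false_imp_iff, true_and,
        forall_eq]
      exact and_congr_right fun _ => forall_congr' fun j => by rw [eq_comm]
    simp only [hall, Fin.val_castSucc, lt_irrefl, false_and, if_false, one_mul, if_true, hne,
      mul_one]
    refine Fin.cases ?_ (fun j => ?_) s
    · have h0 : ∀ j : Fin k, (0 : Fin (k + 1)) ≠ j.succ := fun j => (Fin.succ_ne_zero j).symm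
      simp only [h0, false_imp_iff, implies_true, and_true, Fin.cases_zero]
      exact sum_stepRow_diagClass hm 0
    · simp only [Fin.succ_inj, Fin.cases_succ]
      cases hJ : J j
      · have h2 : ∀ b, (b ≠ some (diagClass j.succ) ∧
            ∀ i, j = i → J i = false → b = some (nextClass i)) ↔ b = some (nextClass j) := by
          intro b
          constructor
          · exact fun h => h.2 j rfl hJ
          · rintro rfl
            refine ⟨fun h => nextClass_ne_diagClass j (Option.some_inj.1 h), ?_⟩
            rintro i rfl -
            rfl
        simp only [h2, Finset.sum_ite_eq', Finset.mem_univ, if_true]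
        simpa [nextClass] using stepRow_some_of_castSucc hm j.succ j.succ j.succ.succ
      · have h2 : ∀ b, (b ≠ some (diagClass j.succ) ∧
            ∀ i, j = i → J i = false → b = some (nextClass i)) ↔ b ≠ some (diagClass j.succ) := by
          intro b
          refine ⟨fun h => h.1, fun h => ⟨h, ?_⟩⟩
          rintro i rfl hi
          simp [hJ] at hi
        simp only [h2]
        exact sum_stepRow_diagClass hm j.succ
  by_cases h2 : t = s.succ
  · subst h2
    have hall : ∀ b, Allowed J (s, s.succ) b ↔ ∀ j : Fin k, s = j.castSucc →
        b = if J j then some (nextClass j) else some (diagClass j.succ) := by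
      intro b
      simp [Allowed, hdiag, hsc, h1]
    have h3 : ¬ ((s.succ : Fin (k + 1 + 1)) : ℕ) < s := by simp
    simp only [hall, h3, h1, false_and, if_false, one_mul, if_true]
    clear h1 hdiag hsc hall h3
    refine Fin.lastCases ?_ (fun j => ?_) s
    · have h0 : ∀ j : Fin k, Fin.last k ≠ j.castSucc := fun j => (Fin.castSucc_lt_last j).ne'
      simp only [h0, false_imp_iff, implies_true, if_true, Fin.lastCases_last]
      have h4 : m (Fin.last k, (Fin.last k).succ) = 1 := by
        rw [hm, Fintype.sum_option, Finset.sum_eq_zero]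
        · simp [stepWeight]
        · intro b _
          have : (Fin.last (k + 1)) ≠ b.1.castSucc := (Fin.castSucc_lt_last b.1).ne'
          simp [stepWeight, this]
      rw [sum_stepRow hm, h4]
      simp
    · simp only [Fin.castSucc_inj, forall_eq', Fin.lastCases_castSucc, Finset.sum_ite_eq',
        Finset.mem_univ, if_true]
      rw [show j.castSucc.succ = j.succ.castSucc from rfl]
      split_ifs
      · exact stepRow_some_of_castSucc hm j.castSucc j.succ j.succ.succ
      · exact stepRow_some_of_castSucc hm j.castSucc j.succ j.succ.castSucc
  · have hall : ∀ b, Allowed J (s, t) b := by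
      intro b
      simp [Allowed, hdiag, hsc, h1, h2]
    simp only [hall, if_true, h1, h2, if_false, mul_one, sum_stepRow hm]
    by_cases h3 : 0 < m (s, t)
    · have h4 := hstep (s, t) h3.ne'
      have h5 : (t : ℕ) ≠ s := fun h => h1 (Fin.ext h)
      have h6 : (t : ℕ) ≠ s + 1 := fun h => h2 (Fin.ext h)
      have h7 : (t : ℕ) < s := by simp only at h4; omega
      simp [h3, h7]
    · simp [h3]

theorem acyclicSum_stepRow (hm : ∀ a, m a = ∑ b, stepWeight q a b)
    (hq : ∀ s t v, q s t v ≠ 0 → m (t, v) ≠ 0)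
    (hstep : ∀ a, m a ≠ 0 → (a.2 : ℕ) ≤ a.1 + 1) (hpos : ∀ s, ∃ t, m (s, t) ≠ 0) :
    acyclicSum (stepRow m q) =
      (∏ s : Fin (k + 1), ∏ t : Fin (k + 1),
        if t < s ∧ 0 < m (s, t.castSucc) then (m (s, t.castSucc) : ℚ) else 1) *
      (loopFree m q 0 * ∏ j : Fin k, ((q j.castSucc j.succ j.succ.succ : ℚ) * loopFree m q j.succ +
        (q j.castSucc j.succ j.succ.castSucc : ℚ) * q j.succ j.succ j.succ.succ)) := by
  classical
  have hlow : ∀ s : Fin (k + 1), (∏ t : Fin (k + 1 + 1),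
      if (t : ℕ) < s ∧ 0 < m (s, t) then (m (s, t) : ℚ) else 1) =
      ∏ t : Fin (k + 1), if t < s ∧ 0 < m (s, t.castSucc) then (m (s, t.castSucc) : ℚ) else 1 := by
    intro s
    rw [Fin.prod_univ_castSucc, if_neg, mul_one]
    · rfl
    · have := s.isLt
      simp only [Fin.val_last]
      omega
  rw [acyclicSum_stepRow_eq_sum hq hstep hpos]
  simp_rw [Fintype.prod_prod_type, sum_allowed hm hstep, Finset.prod_mul_distrib, hlow,
    Finset.prod_ite_eq', Finset.mem_univ, if_true]
  simp_rw [Fin.prod_univ_succ (n := k) (fun s => (Fin.cases (loopFree m q 0) _ s : ℚ)),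
    Fin.prod_univ_castSucc (n := k) (fun s => (Fin.lastCases 1 _ s : ℚ))]
  simp only [Fin.cases_zero, Fin.cases_succ, Fin.lastCases_last, Fin.lastCases_castSucc, mul_one]
  simp_rw [mul_assoc, ← Finset.mul_sum, ← Finset.prod_mul_distrib]
  congr 2
  have h := Finset.prod_univ_sum (fun _ : Fin k => (Finset.univ : Finset Bool)) fun j b =>
    (if b then loopFree m q j.succ else (q j.succ j.succ j.succ.succ : ℚ)) *
      if b then (q j.castSucc j.succ j.succ.succ : ℚ) else q j.castSucc j.succ j.succ.castSucc
  rw [Fintype.piFinset_univ] at h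
  rw [← h]
  refine Finset.prod_congr rfl fun j _ => ?_
  rw [Fintype.sum_bool]
  simp only [if_true, Bool.false_eq_true, if_false]
  ring

end StepClasses
theorem card_filter_fibers {β : Type*} [Fintype β] [DecidableEq β] (n : ℕ) (N : β → ℕ)
    (hN : ∑ b, N b = n) :
    (Finset.univ.filter fun f : Fin n → β =>
      ∀ b, (Finset.univ.filter fun i => f i = b).card = N b).card * ∏ b, (N b)! = n ! := by
  induction n generalizing N with
  | zero =>
    have h0 : ∀ b, N b = 0 := fun b => Finset.sum_eq_zero_iff.1 hN b (Finset.mem_univ b)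
    simp [h0]
  | succ n ih =>
    rw [Finset.card_eq_sum_card_fiberwise (f := fun f : Fin (n + 1) → β => f 0)
      (t := Finset.univ) (fun _ _ => Finset.mem_coe.2 (Finset.mem_univ _)), Finset.sum_mul,
      show (n + 1)! = ∑ b, N b * (n)! by rw [← Finset.sum_mul, hN, Nat.factorial_succ]]
    refine Finset.sum_congr rfl fun b _ => ?_
    rcases Nat.eq_zero_or_pos (N b) with hb | hb
    · rw [hb, zero_mul, mul_eq_zero]
      left
      rw [Finset.card_eq_zero, Finset.filter_eq_empty_iff]
      intro f hf hfb
      have h1 := (Finset.mem_filter.1 hf).2 b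
      rw [hb, Finset.card_eq_zero] at h1
      exact Finset.notMem_empty (0 : Fin (n + 1))
        (h1 ▸ Finset.mem_filter.2 ⟨Finset.mem_univ _, hfb⟩)
    · set N' : β → ℕ := Function.update N b (N b - 1) with hN'
      have hadd : ∀ b', N b' = (if b = b' then 1 else 0) + N' b' := by
        intro b'
        rcases eq_or_ne b' b with rfl | h
        · simp [hN']; omega
        · simp [hN', h, h.symm]
      have hsum : ∑ b, N' b = n := by
        simp_rw [hadd, Finset.sum_add_distrib] at hN
        simp at hN
        omega
      have hprod : ∏ b, (N b)! = N b * ∏ b, (N' b)! := by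
        rw [← Finset.mul_prod_erase _ _ (Finset.mem_univ b),
          ← Finset.mul_prod_erase _ (fun b => (N' b)!) (Finset.mem_univ b), ← mul_assoc]
        congr 1
        · simp only [hN', Function.update_self]
          exact (Nat.mul_factorial_pred hb.ne').symm
        · refine Finset.prod_congr rfl fun x hx => ?_
          simp [hN', Finset.ne_of_mem_erase hx]
      have hcount : ∀ f : Fin (n + 1) → β, f 0 = b →
          ((∀ b', (Finset.univ.filter fun i => f i = b').card = N b') ↔
            ∀ b', (Finset.univ.filter fun i => Fin.tail f i = b').card = N' b') := by
        intro f hf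
        refine forall_congr' fun b' => ?_
        rw [Fin.card_filter_univ_succ, hf, hadd b']
        by_cases h : b = b'
        · simp only [h, if_true]
          rw [add_comm 1]
          exact Nat.add_right_cancel_iff
        · simp only [h, if_false, zero_add]
          rfl
      rw [hprod, ← ih N' hsum]
      rw [← mul_assoc, mul_comm _ (N b), mul_assoc]
      congr 2
      refine Finset.card_nbij' Fin.tail (fun g => Fin.cons b g) ?_ ?_ ?_ ?_
      · intro f hf
        simp only [Finset.coe_filter, Finset.mem_filter, Finset.mem_univ, true_and,
          Set.mem_ofPred_eq] at hf ⊢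
        exact (hcount f hf.2).1 hf.1
      · intro g hg
        simp only [Finset.coe_filter, Finset.mem_filter, Finset.mem_univ, true_and,
          Set.mem_ofPred_eq, Fin.cons_zero, and_true] at hg ⊢
        rw [hcount (Fin.cons b g : Fin (n + 1) → β) rfl, Fin.tail_cons]
        exact hg
      · intro f hf
        simp only [Finset.coe_filter, Set.mem_ofPred_eq] at hf
        simp [← hf.2]
      · intro g _
        simp

section Profiles

variable {k : ℕ} {n : Fin (k + 1) → ℕ}

/-- A complete degree type without the type of the vertex. -/
abbrev DegreeType (n : Fin (k + 1) → ℕ) : Type := Fin (k + 1 + 1) × IndegType n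

/-- The type of a vertex, or the extra type. -/
def parentType : Option (Vertex n) → Fin (k + 1 + 1)
  | none => Fin.last (k + 1)
  | some p => p.1.castSucc

theorem card_typed_preimage_le (f : Vertex n → Option (Vertex n)) (v : Vertex n)
    (s : Fin (k + 1)) : (Finset.univ.filter fun w => w.1 = s ∧ f w = some v).card < n s + 1 := by
  have h1 : (Finset.univ.filter fun w : Vertex n => w.1 = s ∧ f w = some v) ⊆
      Finset.univ.map (Function.Embedding.sigmaMk s) := by
    rintro ⟨t, i⟩ hw
    obtain ⟨rfl, -⟩ := (Finset.mem_filter.1 hw).2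
    simp
  have h2 := Finset.card_le_card h1
  simp only [Finset.card_map, Finset.card_univ, Fintype.card_fin] at h2
  omega

/-- The parent type and the indegrees of every vertex with respect to the parent map `f`. -/
def profile (f : Vertex n → Option (Vertex n)) (v : Vertex n) : DegreeType n :=
  (parentType (f v), fun s => ⟨_, card_typed_preimage_le f v s⟩)

/-- The assignments of degree types to the vertices with the numbers `N` of degree types. -/
def assignments (N : Fin (k + 1) → Fin (k + 1 + 1) → IndegType n → ℕ) :
    Finset (Vertex n → DegreeType n) :=
  {κ | ∀ t u c, (Finset.univ.filter fun v : Vertex n => v.1 = t ∧ κ v = (u, c)).card = N t u c}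

/-- The class of a vertex: its type and the type of its parent. -/
def vertexClass (κ : Vertex n → DegreeType n) (v : Vertex n) : VertexClass k := (v.1, (κ v).1)

/-- The number of children of class `a` of a vertex, according to `κ`; the fictitious parent of the
root has one child of the last type. -/
def childCount (κ : Vertex n → DegreeType n) (a : VertexClass k) : Option (Vertex n) → ℕ
  | none => if a.2 = Fin.last (k + 1) ∧ a.1 = Fin.last k then 1 else 0
  | some w => if a.2 = w.1.castSucc then (κ w).2 a.1 else 0

variable {N : Fin (k + 1) → Fin (k + 1 + 1) → IndegType n → ℕ}

open Classical in
/-- The parent maps of the trees with complete degree types counted by `N`. -/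
noncomputable def parentMaps (N : Fin (k + 1) → Fin (k + 1 + 1) → IndegType n → ℕ) :
    Finset (Vertex n → Option (Vertex n)) :=
  {f | AcyclicMap f ∧ (∃ r : Vertex n, r.1 = Fin.last k ∧ ∀ v, f v = none ↔ v = r) ∧
    profile f ∈ assignments N}

theorem RootedTree.hasParentType_iff (T : RootedTree n) (v : Vertex n) (u : Fin (k + 1 + 1)) :
    T.HasParentType v u ↔ parentType (T.parentMap v) = u := by
  unfold HasParentType
  cases h : T.parentMap v with
  | none =>
    have hv := T.parentMap_eq_none_iff.1 h
    subst hv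
    simp [T.not_isChild_root, parentType, eq_comm]
  | some p =>
    have hp := T.parentMap_eq_some_iff.1 h
    have hv : v ≠ T.root := by rintro rfl; exact T.not_isChild_root p hp
    simp only [hv, false_and, false_or, parentType]
    constructor
    · rintro ⟨q, hq, rfl⟩
      rw [T.isChild_unique hp hq]
    · rintro rfl
      exact ⟨p, hp, rfl⟩

theorem RootedTree.indegree_eq (T : RootedTree n) (s : Fin (k + 1)) (v : Vertex n) :
    T.indegree s v = ((profile T.parentMap v).2 s : ℕ) := by
  change _ = (Finset.univ.filter fun w : Vertex n => w.1 = s ∧ T.parentMap w = some v).card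
  unfold indegree
  rw [← Set.ncard_coe_finset]
  congr 1
  ext w
  simp [T.parentMap_eq_some_iff]

theorem RootedTree.completeTypeCount_eq (T : RootedTree n) (t : Fin (k + 1))
    (u : Fin (k + 1 + 1)) (c : IndegType n) :
    T.completeTypeCount t u (fun s => c s) =
      (Finset.univ.filter fun v : Vertex n => v.1 = t ∧ profile T.parentMap v = (u, c)).card := by
  unfold completeTypeCount
  rw [← Set.ncard_coe_finset]
  congr 1
  ext v
  simp only [Set.mem_ofPred_eq, Finset.coe_filter, Finset.mem_univ, true_and, T.hasParentType_iff,
    T.indegree_eq, Prod.ext_iff, funext_iff, Fin.ext_iff]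
  rfl

theorem mem_treesOfCompleteType_iff (T : RootedTree n) :
    T ∈ treesOfCompleteType (Fin.last k) N ↔ T.parentMap ∈ parentMaps N := by
  classical
  rw [parentMaps, Finset.mem_filter, assignments, Finset.mem_filter]
  simp only [treesOfCompleteType, Set.mem_ofPred_eq, Finset.mem_univ, true_and,
    T.completeTypeCount_eq, T.acyclicMap_parentMap, T.parentMap_eq_none_iff]
  refine and_congr_left fun _ => ⟨fun h => ⟨T.root, h, fun v => Iff.rfl⟩, ?_⟩
  rintro ⟨r, hr, h⟩
  rw [(h T.root).1 rfl, hr]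

theorem ncard_treesOfCompleteType :
    (treesOfCompleteType (Fin.last k) N).ncard = (parentMaps N).card := by
  rw [← Set.ncard_image_of_injective _ RootedTree.parentMap_injective, ← Set.ncard_coe_finset]
  congr 1
  ext f
  simp only [Set.mem_image, Finset.mem_coe, mem_treesOfCompleteType_iff]
  constructor
  · rintro ⟨T, hT, rfl⟩
    exact hT
  · intro hf
    have h := hf
    simp only [parentMaps, Finset.mem_filter, Finset.mem_univ, true_and] at h
    obtain ⟨h1, ⟨r, -, hr⟩, -⟩ := h
    obtain ⟨T, rfl⟩ := RootedTree.exists_parentMap_eq h1 hr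
    exact ⟨T, hf, rfl⟩

theorem mem_forestMaps_iff_profile {f : Vertex n → Option (Vertex n)}
    {κ : Vertex n → DegreeType n} (hκ : κ ∈ assignments N) :
    f ∈ forestMaps (vertexClass κ) Finset.univ (childCount κ) ↔
      f ∈ parentMaps N ∧ profile f = κ := by
  simp only [forestMaps, parentMaps, Finset.mem_filter, Finset.mem_univ, true_and, not_true_eq_false,
    false_imp_iff, implies_true]
  constructor
  · rintro ⟨hac, hcount⟩
    have hpos : ∀ v, childCount κ (vertexClass κ v) (f v) ≠ 0 := by
      intro v
      rw [← hcount, ← Nat.pos_iff_ne_zero, Finset.card_pos]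
      exact ⟨v, by simp⟩
    have hpt : ∀ v, parentType (f v) = (κ v).1 := by
      intro v
      have h := hpos v
      cases hf : f v with
      | none =>
        simp only [hf, childCount, vertexClass] at h
        exact (ite_ne_right_iff.1 h).1.1.symm
      | some p =>
        simp only [hf, childCount, vertexClass] at h
        exact (ite_ne_right_iff.1 h).1.symm
    have hprof : profile f = κ := by
      funext v
      refine Prod.ext (hpt v) (funext fun s => Fin.ext ?_)
      have h := hcount (s, v.1.castSucc) (some v)
      simp only [childCount, if_true] at h
      rw [← h]
      change (Finset.univ.filter fun w : Vertex n => w.1 = s ∧ f w = some v).card = _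
      congr 1
      refine Finset.filter_congr fun w _ => ?_
      simp only [vertexClass, Prod.mk.injEq, and_assoc]
      refine and_congr_right fun _ => ⟨fun hw => ⟨?_, hw⟩, fun hw => hw.2⟩
      rw [← hpt w, hw]
      rfl
    refine ⟨⟨hac, ?_, hprof ▸ hκ⟩, hprof⟩
    have h := hcount (Fin.last k, Fin.last (k + 1)) none
    simp only [childCount, and_self, if_true, Finset.card_eq_one] at h
    obtain ⟨r, hr⟩ := h
    have hr' : ∀ v, (vertexClass κ v = (Fin.last k, Fin.last (k + 1)) ∧ f v = none) ↔ v = r := by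
      intro v
      simpa using Finset.ext_iff.1 hr v
    refine ⟨r, congrArg Prod.fst ((hr' r).2 rfl).1, fun v => ⟨fun hv => ?_, ?_⟩⟩
    · refine (hr' v).1 ⟨?_, hv⟩
      have h := hpos v
      simp only [hv, childCount] at h
      exact Prod.ext (ite_ne_right_iff.1 h).1.2 (ite_ne_right_iff.1 h).1.1
    · rintro rfl
      exact ((hr' v).2 rfl).2
  · rintro ⟨⟨hac, ⟨r, hr, hroot⟩, -⟩, rfl⟩
    refine ⟨hac, ?_⟩
    rintro ⟨s, u⟩ (_ | p)
    · simp only [childCount]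
      have h1 : (Finset.univ.filter fun v => vertexClass (profile f) v = (s, u) ∧ f v = none) =
          if u = Fin.last (k + 1) ∧ s = Fin.last k then {r} else ∅ := by
        have hfr := (hroot r).2 rfl
        ext v
        simp only [Finset.mem_filter, Finset.mem_univ, true_and, hroot, vertexClass, profile,
          Prod.mk.injEq]
        split_ifs with h
        · rw [Finset.mem_singleton]
          refine ⟨fun h => h.2, ?_⟩
          rintro rfl
          rw [h.1, h.2, hr, hfr]
          exact ⟨⟨rfl, rfl⟩, rfl⟩
        · simp only [Finset.notMem_empty, iff_false]
          rintro ⟨⟨h2, h3⟩, rfl⟩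
          refine h ⟨?_, ?_⟩
          · rw [← h3, hfr]; rfl
          · rw [← h2, hr]
      rw [h1]
      split_ifs <;> simp
    · simp only [childCount]
      split_ifs with h
      · change _ = (Finset.univ.filter fun w : Vertex n => w.1 = s ∧ f w = some p).card
        congr 1
        refine Finset.filter_congr fun w _ => ?_
        simp only [vertexClass, profile, Prod.mk.injEq, and_assoc]
        refine and_congr_right fun _ => ⟨fun hw => hw.2, fun hw => ⟨?_, hw⟩⟩
        rw [hw, h]
        rfl
      · rw [Finset.card_eq_zero, Finset.filter_eq_empty_iff]
        rintro v - ⟨h1, h2⟩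
        refine h ?_
        have h3 := congrArg Prod.snd h1
        simp only [vertexClass, profile, h2] at h3
        exact h3.symm

theorem card_parentMaps :
    (parentMaps N).card = ∑ κ ∈ assignments N,
      (forestMaps (vertexClass κ) Finset.univ (childCount κ)).card := by
  rw [Finset.card_eq_sum_card_fiberwise (f := profile) (t := assignments N)]
  · refine Finset.sum_congr rfl fun κ hκ => ?_
    congr 1
    ext f
    rw [mem_forestMaps_iff_profile hκ, Finset.mem_filter]
  · intro f hf
    simp only [parentMaps, Finset.coe_filter, Finset.mem_univ, true_and, Set.mem_ofPred_eq] at hf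
    exact hf.2.2

@[to_additive]
theorem prod_assignment {M : Type*} [CommMonoid M] {κ : Vertex n → DegreeType n}
    (hκ : κ ∈ assignments N) (g : Fin (k + 1) → Fin (k + 1 + 1) → IndegType n → M) :
    ∏ v : Vertex n, g v.1 (κ v).1 (κ v).2 = ∏ t, ∏ u, ∏ c, g t u c ^ N t u c := by
  rw [← Finset.prod_fiberwise' Finset.univ (fun v : Vertex n => (v.1, κ v))
    (fun x => g x.1 x.2.1 x.2.2)]
  simp_rw [Finset.prod_const, Fintype.prod_prod_type]
  refine Finset.prod_congr rfl fun t _ => Finset.prod_congr rfl fun u _ =>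
    Finset.prod_congr rfl fun c _ => ?_
  simp only [assignments, Finset.mem_filter, Finset.mem_univ, true_and] at hκ
  rw [← hκ t u c]
  simp only [Prod.mk.injEq]

theorem card_vertexClass_eq {κ : Vertex n → DegreeType n} (hκ : κ ∈ assignments N)
    (a : VertexClass k) :
    (Finset.univ.filter fun v => vertexClass κ v = a).card = m₂ N a.1 a.2 := by
  have h := sum_assignment hκ fun t u _ => if (t, u) = a then 1 else 0
  rw [Finset.card_filter]
  refine h.trans ?_
  obtain ⟨s, u⟩ := a
  simp only [Prod.mk.injEq, smul_eq_mul, mul_ite, mul_one, mul_zero, m₂]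
  rw [Finset.sum_eq_single_of_mem s (Finset.mem_univ s) (fun t _ ht => by simp [ht]),
    Finset.sum_eq_single_of_mem u (Finset.mem_univ u) (fun t _ ht => by simp [ht])]
  simp

theorem classWeight_childCount {κ : Vertex n → DegreeType n} (hκ : κ ∈ assignments N)
    (a : VertexClass k) (b : Option (VertexClass k)) :
    classWeight (vertexClass κ) (childCount κ) a b = stepWeight (m₃ N) a b := by
  unfold classWeight
  rw [Fintype.sum_option]
  cases b with
  | none => simp [stepWeight, childCount]
  | some b =>
    obtain ⟨t, v⟩ := b
    have h := sum_assignment hκ fun t' u c => if t' = t ∧ u = v then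
      (if a.2 = t.castSucc then (c a.1 : ℕ) else 0) else 0
    have h1 : ∑ w : Vertex n, (if (some w).map (vertexClass κ) = some (t, v) then
        childCount κ a (some w) else 0) = ∑ w : Vertex n, if w.1 = t ∧ (κ w).1 = v then
      (if a.2 = t.castSucc then ((κ w).2 a.1 : ℕ) else 0) else 0 := by
      refine Finset.sum_congr rfl fun w _ => ?_
      simp only [Option.map_some, Option.some_inj, vertexClass, Prod.mk.injEq, childCount]
      by_cases hw : w.1 = t ∧ (κ w).1 = v
      · simp only [hw, and_self, if_true]
      · simp only [hw, if_false]
    rw [h1, h]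
    simp only [Option.map_none, reduceCtorEq, if_false, zero_add, stepWeight, m₃, smul_eq_mul]
    rw [Finset.sum_eq_single_of_mem t (Finset.mem_univ t) (fun t' _ ht => by simp [ht]),
      Finset.sum_eq_single_of_mem v (Finset.mem_univ v) (fun t' _ ht => by simp [ht])]
    by_cases h2 : a.2 = t.castSucc <;> simp [h2, mul_comm]

theorem sum_childCount {κ : Vertex n → DegreeType n} (hκ : κ ∈ assignments N)
    (a : VertexClass k) : ∑ w, childCount κ a w = ∑ b, stepWeight (m₃ N) a b := by
  simp_rw [← classWeight_childCount hκ, sum_classWeight]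

theorem compatible_iff_eq_sum_stepWeight :
    Compatible (Fin.last k) N ↔ ∀ a : VertexClass k, m₂ N a.1 a.2 = ∑ b, stepWeight (m₃ N) a b := by
  have h1 : ∀ s : Fin (k + 1), ∑ b, stepWeight (m₃ N) (s, Fin.last (k + 1)) b =
      if s = Fin.last k then 1 else 0 := by
    intro s
    rw [Fintype.sum_option, Finset.sum_eq_zero]
    · simp [stepWeight]
    · intro b _
      have h2 : Fin.last (k + 1) ≠ b.1.castSucc := (Fin.castSucc_lt_last b.1).ne'
      simp [stepWeight, h2]
  have h2 : ∀ s t : Fin (k + 1), ∑ b, stepWeight (m₃ N) (s, t.castSucc) b =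
      ∑ u, m₃ N s t u := by
    intro s t
    rw [Fintype.sum_option, Fintype.sum_prod_type,
      Finset.sum_eq_single_of_mem t (Finset.mem_univ t)]
    · have h3 : t.castSucc ≠ Fin.last (k + 1) := (Fin.castSucc_lt_last t).ne
      simp [stepWeight, h3]
    · intro t' _ ht
      refine Finset.sum_eq_zero fun u _ => ?_
      have h3 : t.castSucc ≠ t'.castSucc := fun h => ht (Fin.castSucc_inj.1 h).symm
      simp [stepWeight, h3]
  constructor
  · rintro ⟨h3, h4⟩ ⟨s, u⟩
    refine Fin.lastCases ?_ (fun t => ?_) u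
    · rw [h1, ← h3]
    · rw [h2, ← h4]
  · exact fun h => ⟨fun s => by rw [← h1, ← h], fun s t => by rw [← h2, ← h]⟩

theorem compatible_of_mem_parentMaps {f : Vertex n → Option (Vertex n)}
    (hf : f ∈ parentMaps N) : Compatible (Fin.last k) N := by
  have hκ : profile f ∈ assignments N := by
    simp only [parentMaps, Finset.mem_filter] at hf
    exact hf.2.2.2
  have h := (mem_forestMaps_iff_profile hκ).2 ⟨hf, rfl⟩
  simp only [forestMaps, Finset.mem_filter] at h
  rw [compatible_iff_eq_sum_stepWeight]
  intro a
  rw [← card_vertexClass_eq hκ, ← sum_childCount hκ,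
    Finset.card_eq_sum_card_fiberwise (f := f) (t := Finset.univ)
      (fun _ _ => Finset.mem_coe.2 (Finset.mem_univ _))]
  refine Finset.sum_congr rfl fun w _ => ?_
  rw [← h.2.2.2 a w, Finset.filter_filter]

theorem prod_factorial_childCount {κ : Vertex n → DegreeType n} (hκ : κ ∈ assignments N) :
    ∏ a, ∏ w, ((childCount κ a w)! : ℚ) = ∏ᶠ j : ℕ, (j ! : ℚ) ^ indegreeCount N j := by
  have h1 : ∏ a, ∏ w, ((childCount κ a w)! : ℚ) =
      ∏ s, ∏ v : Vertex n, (((κ v).2 s : ℕ)! : ℚ) := by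
    rw [Fintype.prod_prod_type]
    refine Finset.prod_congr rfl fun s _ => ?_
    rw [Finset.prod_comm, Fintype.prod_option, Finset.prod_eq_one, one_mul]
    · refine Finset.prod_congr rfl fun v _ => ?_
      rw [Finset.prod_eq_single_of_mem v.1.castSucc (Finset.mem_univ _)]
      · simp [childCount]
      · intro u _ hu
        simp [childCount, hu]
    · intro u _
      simp only [childCount]
      split_ifs <;> simp
  have h2 : ∀ s, ∏ v : Vertex n, (((κ v).2 s : ℕ)! : ℚ) =
      ∏ t, ∏ u, ∏ c : IndegType n, ((c s : ℕ)! : ℚ) ^ N t u c :=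
    fun s => prod_assignment hκ fun _ _ c => ((c s : ℕ)! : ℚ)
  set S := (finite_mulSupport_factorial N).toFinset ∪ Finset.range (∑ s, n s + 1) with hS
  have h3 : ∀ (s : Fin (k + 1)) (c : IndegType n), (c s : ℕ) ∈ S := by
    intro s c
    refine Finset.mem_union_right _ (Finset.mem_range.2 ?_)
    have := Finset.single_le_sum (f := n) (fun _ _ => Nat.zero_le _) (Finset.mem_univ s)
    have := (c s).isLt
    omega
  rw [h1, finprod_eq_prod_of_mulSupport_subset (s := S) _ (fun j hj => by
    exact Finset.mem_union_left _ ((Set.Finite.mem_toFinset _).2 hj))]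
  have h4 : ∀ j : ℕ, (j ! : ℚ) ^ indegreeCount N j = ∏ s : Fin (k + 1), ∏ t : Fin (k + 1),
      ∏ u : Fin (k + 1 + 1), ∏ c : IndegType n,
        (j ! : ℚ) ^ (if (c s : ℕ) = j then N t u c else 0) := by
    intro j
    simp_rw [indegreeCount, ← Finset.prod_pow_eq_pow_sum]
  have h5 : ∀ s : Fin (k + 1), ∏ j ∈ S, ∏ t : Fin (k + 1), ∏ u : Fin (k + 1 + 1),
      ∏ c : IndegType n, (j ! : ℚ) ^ (if (c s : ℕ) = j then N t u c else 0) =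
      ∏ t, ∏ u, ∏ c : IndegType n, ((c s : ℕ)! : ℚ) ^ N t u c := by
    intro s
    rw [Finset.prod_comm]
    refine Finset.prod_congr rfl fun t _ => ?_
    rw [Finset.prod_comm]
    refine Finset.prod_congr rfl fun u _ => ?_
    rw [Finset.prod_comm]
    refine Finset.prod_congr rfl fun c _ => ?_
    rw [Finset.prod_eq_single_of_mem _ (h3 s c)]
    · simp
    · intro j _ hj
      simp [hj.symm]
  rw [Finset.prod_congr rfl fun j _ => h4 j, Finset.prod_comm (s := S)]
  exact Finset.prod_congr rfl fun s _ => (h2 s).trans (h5 s).symm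

theorem card_assignments (hn : ∀ t, n t = ∑ u, m₂ N t u) :
    (assignments N).card * ∏ t, ∏ u, ∏ c, (N t u c)! = ∏ t, (n t)! := by
  have h1 : (assignments N).card = ∏ t, (Finset.univ.filter fun f : Fin (n t) → DegreeType n =>
      ∀ b, (Finset.univ.filter fun i => f i = b).card = N t b.1 b.2).card := by
    rw [← Fintype.card_piFinset]
    have hcount : ∀ (κ : Vertex n → DegreeType n) t b,
        (Finset.univ.filter fun v : Vertex n => v.1 = t ∧ κ v = b).card =
          (Finset.univ.filter fun i : Fin (n t) => κ ⟨t, i⟩ = b).card := by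
      intro κ t b
      rw [← Finset.card_map (Function.Embedding.sigmaMk (β := fun t => Fin (n t)) t)]
      congr 1
      ext ⟨t', i⟩
      simp only [Finset.mem_filter, Finset.mem_univ, true_and, Finset.mem_map,
        Function.Embedding.sigmaMk_apply]
      constructor
      · rintro ⟨rfl, h⟩
        exact ⟨i, h, rfl⟩
      · rintro ⟨j, hj, h⟩
        cases h
        exact ⟨rfl, hj⟩
    refine Finset.card_nbij' (fun κ t i => κ ⟨t, i⟩) (fun g v => g v.1 v.2) ?_ ?_ ?_ ?_
    · intro κ hκ
      simp only [assignments, Finset.coe_filter, Finset.mem_univ, true_and,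
        Set.mem_ofPred_eq] at hκ
      simp only [Finset.mem_coe, Fintype.mem_piFinset, Finset.mem_filter, Finset.mem_univ,
        true_and]
      intro t b
      rw [← hcount, hκ t b.1 b.2]
    · intro g hg
      simp only [Finset.mem_coe, Fintype.mem_piFinset, Finset.mem_filter, Finset.mem_univ,
        true_and] at hg
      simp only [assignments, Finset.coe_filter, Finset.mem_univ, true_and, Set.mem_ofPred_eq]
      intro t u c
      rw [hcount, hg t (u, c)]
    · intro κ _
      rfl
    · intro g _
      rfl
  rw [h1, ← Finset.prod_mul_distrib]
  refine Finset.prod_congr rfl fun t _ => ?_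
  have h2 : ∑ b : DegreeType n, N t b.1 b.2 = n t := by
    rw [Fintype.sum_prod_type, hn t]
    rfl
  have h3 := card_filter_fibers (n t) (fun b : DegreeType n => N t b.1 b.2) h2
  rw [Fintype.prod_prod_type] at h3
  exact h3

end Profiles
section Enumeration

variable {k : ℕ} {n : Fin (k + 1) → ℕ} {N : Fin (k + 1) → Fin (k + 1 + 1) → IndegType n → ℕ}

/-- The number of trees with a given degree type at every vertex. -/
theorem card_forestMaps_childCount (hpos : ∀ t, 0 < n t) (hn : ∀ t, n t = ∑ u, m₂ N t u)
    (hstep : ∀ (s : Fin (k + 1)) (t : Fin (k + 1 + 1)), 0 < m₂ N s t → (t : ℕ) ≤ (s : ℕ) + 1)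
    (hN : Compatible (Fin.last k) N) {κ : Vertex n → DegreeType n} (hκ : κ ∈ assignments N) :
    ((forestMaps (vertexClass κ) Finset.univ (childCount κ)).card : ℚ) *
        ∏ᶠ j : ℕ, (j ! : ℚ) ^ indegreeCount N j =
      (∏ s : Fin (k + 1), ∏ t : Fin (k + 1),
        if 0 < m₂ N s t.castSucc then ((m₂ N s t.castSucc - 1)! : ℚ) else 1) *
      ((∏ s : Fin (k + 1), ∏ t : Fin (k + 1),
        if t < s ∧ 0 < m₂ N s t.castSucc then (m₂ N s t.castSucc : ℚ) else 1) *
      (mu N 0 * ∏ j : Fin k, ((m₃ N j.castSucc j.succ j.succ.succ : ℚ) * mu N j.succ +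
        (m₃ N j.castSucc j.succ j.succ.castSucc : ℚ) * m₃ N j.succ j.succ j.succ.succ))) := by
  set m : VertexClass k → ℕ := fun a => m₂ N a.1 a.2 with hmdef
  have hm : ∀ a, m a = ∑ b, stepWeight (m₃ N) a b := compatible_iff_eq_sum_stepWeight.1 hN
  have htot : ∀ a, ∑ w, childCount κ a w = m a := fun a => by rw [sum_childCount hκ, hm]
  have hrow : rowWeight (vertexClass κ) (childCount κ) = stepRow m (m₃ N) := by
    funext a b
    rw [rowWeight, stepRow, htot, classWeight_childCount hκ]
  have hq : ∀ s t v, m₃ N s t v ≠ 0 → m (t, v) ≠ 0 := by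
    intro s t v h h0
    refine h (Finset.sum_eq_zero fun c _ => ?_)
    rw [Finset.sum_eq_zero_iff.1 h0 c (Finset.mem_univ c), mul_zero]
  have hex : ∀ s, ∃ t, m (s, t) ≠ 0 := by
    intro s
    have h := (hpos s).ne'
    rw [hn s] at h
    obtain ⟨t, -, ht⟩ := Finset.exists_ne_zero_of_sum_ne_zero h
    exact ⟨t, ht⟩
  have hfac : ∏ a, ((∑ w, childCount κ a w - 1)! : ℚ) = ∏ s : Fin (k + 1), ∏ t : Fin (k + 1),
      if 0 < m₂ N s t.castSucc then ((m₂ N s t.castSucc - 1)! : ℚ) else 1 := by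
    simp_rw [htot]
    rw [Fintype.prod_prod_type]
    refine Finset.prod_congr rfl fun s _ => ?_
    rw [Fin.prod_univ_castSucc]
    have h1 : (m (s, Fin.last (k + 1)) - 1)! = 1 := by
      simp only [hmdef, hN.1]
      split_ifs <;> rfl
    rw [h1, Nat.cast_one, mul_one]
    refine Finset.prod_congr rfl fun t _ => ?_
    split_ifs with h
    · rfl
    · have h0 : m (s, t.castSucc) = 0 := Nat.eq_zero_of_not_pos h
      rw [h0]
      simp
  rw [← prod_factorial_childCount hκ, card_forestMaps _ _ _
    (fun a => by rw [card_vertexClass_eq hκ, htot]) (fun _ v hv => absurd (Finset.mem_univ v) hv),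
    hrow, acyclicSum_stepRow hm hq (fun a ha => hstep a.1 a.2 (Nat.pos_of_ne_zero ha)) hex, hfac]
  rfl

theorem prod_factorial_castSucc (hN : Compatible (Fin.last k) N) :
    ∏ t, ∏ u, ∏ c, (N t u c)! = ∏ t, ∏ u : Fin (k + 1), ∏ c, (N t u.castSucc c)! := by
  refine Finset.prod_congr rfl fun t _ => ?_
  rw [Fin.prod_univ_castSucc, Finset.prod_eq_one (s := Finset.univ)
    (f := fun c => (N t (Fin.last (k + 1)) c)!), mul_one]
  intro c _
  have h1 : N t (Fin.last (k + 1)) c ≤ m₂ N t (Fin.last (k + 1)) :=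
    Finset.single_le_sum (f := fun c => N t (Fin.last (k + 1)) c) (fun _ _ => Nat.zero_le _)
      (Finset.mem_univ c)
  rw [hN.1] at h1
  refine Nat.factorial_eq_one.2 (h1.trans ?_)
  split_ifs <;> simp

theorem finprod_factorial_ne_zero : ∏ᶠ j : ℕ, (j ! : ℚ) ^ indegreeCount N j ≠ 0 := by
  rw [finprod_eq_prod _ (finite_mulSupport_factorial N)]
  exact Finset.prod_ne_zero_iff.2 fun j _ => pow_ne_zero _ (by exact_mod_cast j.factorial_ne_zero)

end Enumeration

end MultitypeCayley

theorem mainTheorem8 (k : ℕ) (n : Fin (k + 1) → ℕ) (hpos : ∀ t, 0 < n t)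
    (N : Fin (k + 1) → Fin (k + 1 + 1) → MultitypeCayley.IndegType n → ℕ)
    (hn : ∀ t, n t = ∑ u, MultitypeCayley.m₂ N t u)
    (hstep : ∀ (s : Fin (k + 1)) (t : Fin (k + 1 + 1)),
      0 < MultitypeCayley.m₂ N s t → (t : ℕ) ≤ (s : ℕ) + 1) :
    (MultitypeCayley.Compatible (Fin.last k) N →
      ((MultitypeCayley.treesOfCompleteType (Fin.last k) N).ncard : ℚ) =
        ((∏ t, ((n t)! : ℚ)) *
            ∏ s : Fin (k + 1), ∏ t : Fin (k + 1),
              if 0 < MultitypeCayley.m₂ N s t.castSucc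
                then ((MultitypeCayley.m₂ N s t.castSucc - 1)! : ℚ) else 1) /
          ((∏ t : Fin (k + 1), ∏ u : Fin (k + 1), ∏ c : MultitypeCayley.IndegType n,
              ((N t u.castSucc c)! : ℚ)) *
            ∏ᶠ j : ℕ, (j ! : ℚ) ^ MultitypeCayley.indegreeCount N j) *
        (∏ s : Fin (k + 1), ∏ t : Fin (k + 1),
            if t < s ∧ 0 < MultitypeCayley.m₂ N s t.castSucc
              then (MultitypeCayley.m₂ N s t.castSucc : ℚ) else 1) *
        (MultitypeCayley.mu N 0 *
          ∏ j : Fin k,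
            ((MultitypeCayley.m₃ N j.castSucc j.succ j.succ.succ : ℚ) *
                MultitypeCayley.mu N j.succ +
              (MultitypeCayley.m₃ N j.castSucc j.succ j.succ.castSucc : ℚ) *
                MultitypeCayley.m₃ N j.succ j.succ j.succ.succ))) ∧
    (¬ MultitypeCayley.Compatible (Fin.last k) N →
      MultitypeCayley.treesOfCompleteType (Fin.last k) N = ∅) := by
  open MultitypeCayley in
  refine ⟨fun hN => ?_, fun hN => ?_⟩
  · have hD := prod_factorial_castSucc hN
    have hA := card_assignments hn
    rw [hD] at hA
    have hA' : ((assignments N).card : ℚ) * ∏ t : Fin (k + 1), ∏ u : Fin (k + 1),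
        ∏ c : IndegType n, ((N t u.castSucc c)! : ℚ) = ∏ t, ((n t)! : ℚ) := by
      exact_mod_cast hA
    have hD0 : ∏ t : Fin (k + 1), ∏ u : Fin (k + 1), ∏ c : IndegType n,
        ((N t u.castSucc c)! : ℚ) ≠ 0 :=
      Finset.prod_ne_zero_iff.2 fun t _ => Finset.prod_ne_zero_iff.2 fun u _ =>
        Finset.prod_ne_zero_iff.2 fun c _ => by exact_mod_cast Nat.factorial_ne_zero _
    have hP0 := finprod_factorial_ne_zero (N := N)
    have hF : ∀ κ ∈ assignments N,
        ((forestMaps (vertexClass κ) Finset.univ (childCount κ)).card : ℚ) = _ :=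
      fun κ hκ => eq_div_of_mul_eq hP0 (card_forestMaps_childCount hpos hn hstep hN hκ)
    rw [ncard_treesOfCompleteType, card_parentMaps, Nat.cast_sum, Finset.sum_congr rfl hF,
      Finset.sum_const, nsmul_eq_mul, ← hA']
    field_simp
  · refine Set.eq_empty_of_forall_notMem fun T hT => hN ?_
    exact compatible_of_mem_parentMaps ((mem_treesOfCompleteType_iff T).1 hT)
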